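/- **Theorem (Preservation for Extended $F_{<:Q}$).** Let $\mathcal L$ be a countable bounded lattice, with order $\sqsubseteq$, meet $\sqcap$, join $\sqcup$ and bounds $\top,\bot$. Consider the following calculus. *Syntax* (up to renaming of bound variables; $x$, $X$, $Y$ are term, type and qualifier variables): - qualifiers $P,Q,R ::= l \mid Y \mid Q\wedge R \mid Q\vee R$, with $l\in\mathcal L$; - simple types $S ::= \top \mid X \mid T_1\to T_2 \mid \forall(X<:S).T \mid \forall(Y<:Q).T$; - qualified types $T ::= \{Q\}\,S$; - values $v ::= \lambda(x:T)_P.t \mid \Lambda(X<:S)_P.t \mid \Lambda(Y<:Q)_P.t$, where $P$ is the tag of the value; - terms $s,t ::= x \mid v \mid s\,t \mid s[S] \mid s\{\!\{Q\}\!\} \mid \mathsf{upqual}\,P\,s \mid \mathsf{assert}\,P\,s$; - environments $\Gamma ::= \varnothing \mid \Gamma,x:T \mid \Gamma,X<:S \mid \Gamma,Y<:Q$. All environments, types and qualifiers in the judgments are well formed: every variable is bound in the environment, and every entry of $\Gamma$ is well formed in the part of $\Gamma$ before it. The partial function $\mathrm{eval}$ from qualifiers to $\mathcal L$ is given by $\mathrm{eval}(l)=l$,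 $\mathrm{eval}(Q\wedge R)=\mathrm{eval}(Q)\sqcap\mathrm{eval}(R)$, $\mathrm{eval}(Q\vee R)=\mathrm{eval}(Q)\sqcup\mathrm{eval}(R)$; it is undefined if a variable occurs. *Subqualification* $\Gamma\vdash Q<:R$ is the least relation such that - $\Gamma\vdash Q<:\top$; $\ \Gamma\vdash\bot<:Q$; $\ \Gamma\vdash Y<:Y$; - if $(Y<:Q)\in\Gamma$ and $\Gamma\vdash Q<:R$, then $\Gamma\vdash Y<:R$; - if $\Gamma\vdash Q<:R_i$ for $i=1$ or $i=2$, then $\Gamma\vdash Q<:R_1\vee R_2$; if $\Gamma\vdash Q_i<:R$ for both $i$, then $\Gamma\vdash Q_1\vee Q_2<:R$; - if $\Gamma\vdash Q<:R_i$ for both $i$, then $\Gamma\vdash Q<:R_1\wedge R_2$; if $\Gamma\vdash Q_i<:R$ for $i=1$ or $i=2$, then $\Gamma\vdash Q_1\wedge Q_2<:R$; - (sq-lift) if $l_1\sqsubseteq l_2$, then $\Gamma\vdash l_1<:l_2$; - (sq-eval-elim) if $\Gamma\vdash Q<:M$, $\mathrm{eval}(M)=l$ and $\Gamma\vdash l<:R$,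 then $\Gamma\vdash Q<:R$; - (sq-eval-intro) if $\Gamma\vdash Q<:l$, $\mathrm{eval}(M)=l$ and $\Gamma\vdash M<:R$, then $\Gamma\vdash Q<:R$. *Subtyping* is the least relation such that - $\Gamma\vdash S<:\top$; $\ \Gamma\vdash X<:X$; if $(X<:S)\in\Gamma$ and $\Gamma\vdash S<:S'$, then $\Gamma\vdash X<:S'$; - if $\Gamma\vdash U_1<:T_1$ and $\Gamma\vdash T_2<:U_2$, then $\Gamma\vdash T_1\to T_2<:U_1\to U_2$; - if $\Gamma\vdash S_2<:S_1$ and $\Gamma,X<:S_2\vdash T_1<:T_2$, then $\Gamma\vdash\forall(X<:S_1).T_1<:\forall(X<:S_2).T_2$; - if $\Gamma\vdash Q_2<:Q_1$ and $\Gamma,Y<:Q_2\vdash T_1<:T_2$, then $\Gamma\vdash\forall(Y<:Q_1).T_1<:\forall(Y<:Q_2).T_2$; - if $\Gamma\vdash Q_1<:Q_2$ and $\Gamma\vdash S_1<:S_2$, then $\Gamma\vdash\{Q_1\}S_1<:\{Q_2\}S_2$. *Typing* is the least relation such that - if $(x:T)\in\Gamma$, then $\Gamma\vdash x:T$; if $\Gamma\vdash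 s:T_1$ and $\Gamma\vdash T_1<:T_2$, then $\Gamma\vdash s:T_2$; - if $\Gamma,x:T_1\vdash t:T_2$, then $\Gamma\vdash\lambda(x:T_1)_P.t:\{P\}(T_1\to T_2)$; if $\Gamma\vdash s:\{Q\}(T_1\to T_2)$ and $\Gamma\vdash t:T_1$, then $\Gamma\vdash s\,t:T_2$; - if $\Gamma,X<:S\vdash t:T$, then $\Gamma\vdash\Lambda(X<:S)_P.t:\{P\}\forall(X<:S).T$; if $\Gamma\vdash s:\{Q\}\forall(X<:S).T$ and $\Gamma\vdash S'<:S$, then $\Gamma\vdash s[S']:T[X\mapsto S']$; - if $\Gamma,Y<:Q\vdash t:T$, then $\Gamma\vdash\Lambda(Y<:Q)_P.t:\{P\}\forall(Y<:Q).T$; if $\Gamma\vdash s:\{R\}\forall(Y<:Q).T$ and $\Gamma\vdash Q'<:Q$, then $\Gamma\vdash s\{\!\{Q'\}\!\}:T[Y\mapsto Q']$; - if $\Gamma\vdash s:\{Q\}S$ and $\Gamma\vdash Q<:P$, then $\Gamma\vdash\mathsf{assert}\,P\,s:\{Q\}S$ and $\Gamma\vdash\mathsf{upqual}\,P\,s:\{P\}S$.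 *Reduction* $s\longrightarrow t$ is call-by-value, generated by - $(\lambda(x:T)_P.t)\,v\longrightarrow t[x\mapsto v]$, $\ (\Lambda(X<:S)_P.t)[S']\longrightarrow t[X\mapsto S']$, $\ (\Lambda(Y<:Q)_P.t)\{\!\{Q'\}\!\}\longrightarrow t[Y\mapsto Q']$; - if $v$ is a value with tag $Q$, and $\mathrm{eval}(Q)$ and $\mathrm{eval}(P)$ are defined with $\mathrm{eval}(Q)\sqsubseteq\mathrm{eval}(P)$, then $\mathsf{assert}\,P\,v\longrightarrow v$, and $\mathsf{upqual}\,P\,v\longrightarrow v'$, where $v'$ is $v$ with its tag replaced by $P$; - reduction in the evaluation contexts $E ::= [\,]\mid E\,t\mid v\,E\mid E[S]\mid E\{\!\{Q\}\!\}\mid\mathsf{upqual}\,P\,E\mid\mathsf{assert}\,P\,E$. Then for every environment $\Gamma$, all terms $s,t$ and every qualified type $T$: if $\Gamma\vdash s:T$ and $s\longrightarrow t$, then $\Gamma\vdash t:T$. -/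

import Mathlib

/-!
The calculus `F<:Q` over a bounded lattice `L` of base qualifiers.

Variables are de Bruijn indices, counted separately for the three sorts: term variables `x`,
type variables `X` (ranging over simple types) and qualifier variables `Y`. Index `0` is the
innermost binder of its sort.
-/

namespace FsubQ

universe u

/-- Qualifier expressions `P, Q, R ::= l | Y | Q ∧ R | Q ∨ R` with `l ∈ L`. -/
inductive Qual (L : Type u) where
  | base (l : L)
  | var (Y : ℕ)
  | meet (Q R : Qual L)
  | join (Q R : Qual L)

mutual
/-- Simple types `S ::= ⊤ | X | T₁ → T₂ | ∀(X <: S). T | ∀(Y <: Q). T`. -/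
inductive STy (L : Type u) where
  | top
  | var (X : ℕ)
  | arrow (T₁ T₂ : QTy L)
  | all (S : STy L) (T : QTy L)
  | qall (Q : Qual L) (T : QTy L)
/-- Qualified types `T ::= {Q} S`. -/
inductive QTy (L : Type u) where
  | mk (Q : Qual L) (S : STy L)
end

/-- Terms
`s, t ::= x | λ(x : T)_P. t | s t | Λ(X <: S)_P. t | s [S] | Λ(Y <: Q)_P. t | s {{Q}}
  | upqual P s | assert P s`;
the subscript `P` is the qualifier tag of the abstraction. -/
inductive Term (L : Type u) where
  | var (x : ℕ)
  | abs (P : Qual L) (T : QTy L) (t : Term L)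
  | app (s t : Term L)
  | tabs (P : Qual L) (S : STy L) (t : Term L)
  | tapp (s : Term L) (S : STy L)
  | qabs (P : Qual L) (Q : Qual L) (t : Term L)
  | qapp (s : Term L) (Q : Qual L)
  | upqual (P : Qual L) (s : Term L)
  | assertq (P : Qual L) (s : Term L)

/-- Environments `Γ ::= ∅ | Γ, x : T | Γ, X <: S | Γ, Y <: Q`. -/
inductive Ctx (L : Type u) where
  | nil
  | tm (Γ : Ctx L) (T : QTy L)
  | ty (Γ : Ctx L) (S : STy L)
  | qu (Γ : Ctx L) (Q : Qual L)

/-! ### Renaming and capture-avoiding simultaneous substitution -/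

/-- Extend a renaming under one binder of the renamed sort. -/
def upRen (ρ : ℕ → ℕ) : ℕ → ℕ
  | 0 => 0
  | n + 1 => ρ n + 1

section Substitution
variable {L : Type u}

def Qual.rename (ρ : ℕ → ℕ) : Qual L → Qual L
  | .base l => .base l
  | .var Y => .var (ρ Y)
  | .meet Q R => .meet (Q.rename ρ) (R.rename ρ)
  | .join Q R => .join (Q.rename ρ) (R.rename ρ)

def Qual.subst (σ : ℕ → Qual L) : Qual L → Qual L
  | .base l => .base l
  | .var Y => σ Y
  | .meet Q R => .meet (Q.subst σ) (R.subst σ)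
  | .join Q R => .join (Q.subst σ) (R.subst σ)

/-- Extend a qualifier substitution under a qualifier binder. -/
def Qual.up (σ : ℕ → Qual L) : ℕ → Qual L
  | 0 => .var 0
  | n + 1 => (σ n).rename Nat.succ

/-- The substitution `[Y ↦ Q]` for the innermost qualifier variable. -/
def Qual.single (Q : Qual L) : ℕ → Qual L
  | 0 => Q
  | n + 1 => .var n

mutual
/-- `ρX` renames type variables, `ρY` renames qualifier variables. -/
def STy.rename (ρX ρY : ℕ → ℕ) : STy L → STy L
  | .top => .top
  | .var X => .var (ρX X)
  | .arrow T₁ T₂ => .arrow (T₁.rename ρX ρY) (T₂.rename ρX ρY)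
  | .all S T => .all (S.rename ρX ρY) (T.rename (upRen ρX) ρY)
  | .qall Q T => .qall (Q.rename ρY) (T.rename ρX (upRen ρY))
def QTy.rename (ρX ρY : ℕ → ℕ) : QTy L → QTy L
  | .mk Q S => .mk (Q.rename ρY) (S.rename ρX ρY)
end

/-- Extend a type substitution under a type binder. -/
def STy.up (τ : ℕ → STy L) : ℕ → STy L
  | 0 => .var 0
  | n + 1 => (τ n).rename Nat.succ id

/-- The substitution `[X ↦ S]` for the innermost type variable. -/
def STy.single (S : STy L) : ℕ → STy L
  | 0 => S
  | n + 1 => .var n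

mutual
/-- `τ` substitutes for type variables, `σ` for qualifier variables. -/
def STy.subst (τ : ℕ → STy L) (σ : ℕ → Qual L) : STy L → STy L
  | .top => .top
  | .var X => τ X
  | .arrow T₁ T₂ => .arrow (T₁.subst τ σ) (T₂.subst τ σ)
  | .all S T => .all (S.subst τ σ) (T.subst (STy.up τ) σ)
  | .qall Q T =>
      .qall (Q.subst σ) (T.subst (fun n => (τ n).rename id Nat.succ) (Qual.up σ))
def QTy.subst (τ : ℕ → STy L) (σ : ℕ → Qual L) : QTy L → QTy L
  | .mk Q S => .mk (Q.subst σ) (S.subst τ σ)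
end

/-- `ρx`, `ρX`, `ρY` rename term, type and qualifier variables. -/
def Term.rename (ρx ρX ρY : ℕ → ℕ) : Term L → Term L
  | .var x => .var (ρx x)
  | .abs P T t => .abs (P.rename ρY) (T.rename ρX ρY) (t.rename (upRen ρx) ρX ρY)
  | .app s t => .app (s.rename ρx ρX ρY) (t.rename ρx ρX ρY)
  | .tabs P S t => .tabs (P.rename ρY) (S.rename ρX ρY) (t.rename ρx (upRen ρX) ρY)
  | .tapp s S => .tapp (s.rename ρx ρX ρY) (S.rename ρX ρY)
  | .qabs P Q t => .qabs (P.rename ρY) (Q.rename ρY) (t.rename ρx ρX (upRen ρY))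
  | .qapp s Q => .qapp (s.rename ρx ρX ρY) (Q.rename ρY)
  | .upqual P s => .upqual (P.rename ρY) (s.rename ρx ρX ρY)
  | .assertq P s => .assertq (P.rename ρY) (s.rename ρx ρX ρY)

/-- Extend a term substitution under a term binder. -/
def Term.up (θ : ℕ → Term L) : ℕ → Term L
  | 0 => .var 0
  | n + 1 => (θ n).rename Nat.succ id id

/-- The substitution `[x ↦ s]` for the innermost term variable. -/
def Term.single (s : Term L) : ℕ → Term L
  | 0 => s
  | n + 1 => .var n

/-- `θ`, `τ`, `σ` substitute for term, type and qualifier variables. -/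
def Term.subst (θ : ℕ → Term L) (τ : ℕ → STy L) (σ : ℕ → Qual L) : Term L → Term L
  | .var x => θ x
  | .abs P T t => .abs (P.subst σ) (T.subst τ σ) (t.subst (Term.up θ) τ σ)
  | .app s t => .app (s.subst θ τ σ) (t.subst θ τ σ)
  | .tabs P S t =>
      .tabs (P.subst σ) (S.subst τ σ)
        (t.subst (fun n => (θ n).rename id Nat.succ id) (STy.up τ) σ)
  | .tapp s S => .tapp (s.subst θ τ σ) (S.subst τ σ)
  | .qabs P Q t =>
      .qabs (P.subst σ) (Q.subst σ)
        (t.subst (fun n => (θ n).rename id id Nat.succ)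
          (fun n => (τ n).rename id Nat.succ) (Qual.up σ))
  | .qapp s Q => .qapp (s.subst θ τ σ) (Q.subst σ)
  | .upqual P s => .upqual (P.subst σ) (s.subst θ τ σ)
  | .assertq P s => .assertq (P.subst σ) (s.subst θ τ σ)

/-- `T[X ↦ S]`. -/
def QTy.substTy (T : QTy L) (S : STy L) : QTy L := T.subst (STy.single S) Qual.var

/-- `T[Y ↦ Q]`. -/
def QTy.substQual (T : QTy L) (Q : Qual L) : QTy L := T.subst STy.var (Qual.single Q)

/-- `t[x ↦ s]`. -/
def Term.substTerm (t s : Term L) : Term L := t.subst (Term.single s) STy.var Qual.var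

/-- `t[X ↦ S]`. -/
def Term.substTy (t : Term L) (S : STy L) : Term L := t.subst Term.var (STy.single S) Qual.var

/-- `t[Y ↦ Q]`. -/
def Term.substQual (t : Term L) (Q : Qual L) : Term L :=
  t.subst Term.var STy.var (Qual.single Q)

end Substitution

/-! ### Environments and well-formedness -/

section Environments
variable {L : Type u}

/-- `Y <: Q ∈ Γ`; the bound is weakened to the whole of `Γ`. -/
inductive HasQual : Ctx L → ℕ → Qual L → Prop
  | here {Γ Q} : HasQual (.qu Γ Q) 0 (Q.rename Nat.succ)
  | qu {Γ Y Q R} : HasQual Γ Y Q → HasQual (.qu Γ R) (Y + 1) (Q.rename Nat.succ)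
  | ty {Γ Y Q S} : HasQual Γ Y Q → HasQual (.ty Γ S) Y Q
  | tm {Γ Y Q T} : HasQual Γ Y Q → HasQual (.tm Γ T) Y Q

/-- `X <: S ∈ Γ`; the bound is weakened to the whole of `Γ`. -/
inductive HasTy : Ctx L → ℕ → STy L → Prop
  | here {Γ S} : HasTy (.ty Γ S) 0 (S.rename Nat.succ id)
  | ty {Γ X S U} : HasTy Γ X S → HasTy (.ty Γ U) (X + 1) (S.rename Nat.succ id)
  | qu {Γ X S R} : HasTy Γ X S → HasTy (.qu Γ R) X (S.rename id Nat.succ)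
  | tm {Γ X S T} : HasTy Γ X S → HasTy (.tm Γ T) X S

/-- `x : T ∈ Γ`; the type is weakened to the whole of `Γ`. -/
inductive HasTerm : Ctx L → ℕ → QTy L → Prop
  | here {Γ T} : HasTerm (.tm Γ T) 0 T
  | tm {Γ x T U} : HasTerm Γ x T → HasTerm (.tm Γ U) (x + 1) T
  | ty {Γ x T S} : HasTerm Γ x T → HasTerm (.ty Γ S) x (T.rename Nat.succ id)
  | qu {Γ x T R} : HasTerm Γ x T → HasTerm (.qu Γ R) x (T.rename id Nat.succ)

/-- All variables of the qualifier are bound in `Γ`. -/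
def Qual.WF (Γ : Ctx L) : Qual L → Prop
  | .base _ => True
  | .var Y => ∃ Q, HasQual Γ Y Q
  | .meet Q R => Q.WF Γ ∧ R.WF Γ
  | .join Q R => Q.WF Γ ∧ R.WF Γ

mutual
/-- All variables of the simple type are bound in `Γ`. -/
def STy.WF : Ctx L → STy L → Prop
  | _, .top => True
  | Γ, .var X => ∃ S, HasTy Γ X S
  | Γ, .arrow T₁ T₂ => T₁.WF Γ ∧ T₂.WF Γ
  | Γ, .all S T => S.WF Γ ∧ T.WF (.ty Γ S)
  | Γ, .qall Q T => Q.WF Γ ∧ T.WF (.qu Γ Q)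
/-- All variables of the qualified type are bound in `Γ`. -/
def QTy.WF : Ctx L → QTy L → Prop
  | Γ, .mk Q S => Q.WF Γ ∧ S.WF Γ
end

/-- Every bound or type in `Γ` is well formed in the part of `Γ` before it. -/
def Ctx.WF : Ctx L → Prop
  | .nil => True
  | .tm Γ T => Γ.WF ∧ T.WF Γ
  | .ty Γ S => Γ.WF ∧ S.WF Γ
  | .qu Γ Q => Γ.WF ∧ Q.WF Γ

end Environments

/-! ### Evaluation of qualifier expressions, subqualification, subtyping, typing -/

section Judgments
variable {L : Type u} [Lattice L]

/-- Partial evaluation of a qualifier expression to an element of `L`: it interprets textual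
meets and joins by those of `L` and is undefined if a variable occurs. -/
def Qual.eval : Qual L → Option L
  | .base l => some l
  | .var _ => none
  | .meet Q R => Q.eval.bind fun a => R.eval.bind fun b => some (a ⊓ b)
  | .join Q R => Q.eval.bind fun a => R.eval.bind fun b => some (a ⊔ b)

variable [BoundedOrder L]

/-- Subqualification `Γ ⊢ Q <: R`. The rules `evalElim` and `evalIntro` carry the transitivity
through a base lattice element `l` and an expression `M` that evaluates to it. With `M = Q`,
respectively `M = R`, they say that `eval Q = l` and `Γ ⊢ l <: R` give `Γ ⊢ Q <: R`, and that
`Γ ⊢ Q <: l` and `eval R = l` give `Γ ⊢ Q <: R`. -/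
inductive Subqual : Ctx L → Qual L → Qual L → Prop
  | top {Γ Q} : Γ.WF → Q.WF Γ → Subqual Γ Q (.base ⊤)
  | bot {Γ Q} : Γ.WF → Q.WF Γ → Subqual Γ (.base ⊥) Q
  | reflVar {Γ Y} : Γ.WF → (Qual.var Y).WF Γ → Subqual Γ (.var Y) (.var Y)
  | var {Γ Y Q R} : HasQual Γ Y Q → Subqual Γ Q R → Subqual Γ (.var Y) R
  | joinIntro₁ {Γ Q R₁ R₂} : Subqual Γ Q R₁ → R₂.WF Γ → Subqual Γ Q (.join R₁ R₂)
  | joinIntro₂ {Γ Q R₁ R₂} : R₁.WF Γ → Subqual Γ Q R₂ → Subqual Γ Q (.join R₁ R₂)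
  | joinElim {Γ Q₁ Q₂ R} : Subqual Γ Q₁ R → Subqual Γ Q₂ R → Subqual Γ (.join Q₁ Q₂) R
  | meetIntro {Γ Q R₁ R₂} : Subqual Γ Q R₁ → Subqual Γ Q R₂ → Subqual Γ Q (.meet R₁ R₂)
  | meetElim₁ {Γ Q₁ Q₂ R} : Subqual Γ Q₁ R → Q₂.WF Γ → Subqual Γ (.meet Q₁ Q₂) R
  | meetElim₂ {Γ Q₁ Q₂ R} : Q₁.WF Γ → Subqual Γ Q₂ R → Subqual Γ (.meet Q₁ Q₂) R
  | lift {Γ l₁ l₂} : Γ.WF → l₁ ≤ l₂ → Subqual Γ (.base l₁) (.base l₂)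
  | evalElim {Γ Q R M l} : Subqual Γ Q M → M.eval = some l → Subqual Γ (.base l) R →
      Subqual Γ Q R
  | evalIntro {Γ Q R M l} : Subqual Γ Q (.base l) → M.eval = some l → Subqual Γ M R →
      Subqual Γ Q R

mutual
/-- Subtyping `Γ ⊢ S₁ <: S₂` of simple types. -/
inductive STy.Sub : Ctx L → STy L → STy L → Prop
  | top {Γ S} : Γ.WF → S.WF Γ → STy.Sub Γ S .top
  | reflVar {Γ X} : Γ.WF → (STy.var X).WF Γ → STy.Sub Γ (.var X) (.var X)
  | var {Γ X S U} : HasTy Γ X S → STy.Sub Γ S U → STy.Sub Γ (.var X) U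
  | arrow {Γ T₁ T₂ U₁ U₂} : QTy.Sub Γ U₁ T₁ → QTy.Sub Γ T₂ U₂ →
      STy.Sub Γ (.arrow T₁ T₂) (.arrow U₁ U₂)
  | all {Γ S₁ S₂ T₁ T₂} : STy.Sub Γ S₂ S₁ → QTy.Sub (.ty Γ S₂) T₁ T₂ →
      STy.Sub Γ (.all S₁ T₁) (.all S₂ T₂)
  | qall {Γ Q₁ Q₂ T₁ T₂} : Subqual Γ Q₂ Q₁ → QTy.Sub (.qu Γ Q₂) T₁ T₂ →
      STy.Sub Γ (.qall Q₁ T₁) (.qall Q₂ T₂)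
/-- Subtyping `Γ ⊢ T₁ <: T₂` of qualified types. -/
inductive QTy.Sub : Ctx L → QTy L → QTy L → Prop
  | qtype {Γ Q₁ Q₂ S₁ S₂} : Subqual Γ Q₁ Q₂ → STy.Sub Γ S₁ S₂ →
      QTy.Sub Γ (.mk Q₁ S₁) (.mk Q₂ S₂)
end

/-- Typing `Γ ⊢ t : T`. -/
inductive Typing : Ctx L → Term L → QTy L → Prop
  | var {Γ x T} : Γ.WF → HasTerm Γ x T → Typing Γ (.var x) T
  | abs {Γ P T₁ t T₂} : P.WF Γ → Typing (.tm Γ T₁) t T₂ →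
      Typing Γ (.abs P T₁ t) (.mk P (.arrow T₁ T₂))
  | app {Γ s t Q T₁ T₂} : Typing Γ s (.mk Q (.arrow T₁ T₂)) → Typing Γ t T₁ →
      Typing Γ (.app s t) T₂
  | tabs {Γ P S t T} : P.WF Γ → Typing (.ty Γ S) t T →
      Typing Γ (.tabs P S t) (.mk P (.all S T))
  | tapp {Γ s Q S S' T} : Typing Γ s (.mk Q (.all S T)) → STy.Sub Γ S' S →
      Typing Γ (.tapp s S') (T.substTy S')
  | qabs {Γ P Q t T} : P.WF Γ → Typing (.qu Γ Q) t T →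
      Typing Γ (.qabs P Q t) (.mk P (.qall Q T))
  | qapp {Γ s R Q Q' T} : Typing Γ s (.mk R (.qall Q T)) → Subqual Γ Q' Q →
      Typing Γ (.qapp s Q') (T.substQual Q')
  | assertq {Γ s P Q S} : Typing Γ s (.mk Q S) → Subqual Γ Q P →
      Typing Γ (.assertq P s) (.mk Q S)
  | upqual {Γ s P Q S} : Typing Γ s (.mk Q S) → Subqual Γ Q P →
      Typing Γ (.upqual P s) (.mk P S)
  | sub {Γ s T₁ T₂} : Typing Γ s T₁ → QTy.Sub Γ T₁ T₂ → Typing Γ s T₂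

end Judgments

/-! ### Call-by-value reduction -/

section Reduction
variable {L : Type u}

/-- `ValueTag v P`: `v` is a value, that is, an abstraction of one of the three kinds, and `P` is
its tag. -/
inductive ValueTag : Term L → Qual L → Prop
  | abs {P T t} : ValueTag (.abs P T t) P
  | tabs {P S t} : ValueTag (.tabs P S t) P
  | qabs {P Q t} : ValueTag (.qabs P Q t) P

def Term.IsValue (v : Term L) : Prop := ∃ P, ValueTag v P

/-- Replace the tag of a value by `P`. -/
def Term.retag (P : Qual L) : Term L → Term L
  | .abs _ T t => .abs P T t
  | .tabs _ S t => .tabs P S t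
  | .qabs _ Q t => .qabs P Q t
  | t => t

/-- One-step reduction `s ⟶ t`. -/
inductive Step [Lattice L] : Term L → Term L → Prop
  | beta {P T t v} : v.IsValue → Step (.app (.abs P T t) v) (t.substTerm v)
  | betaT {P S t S'} : Step (.tapp (.tabs P S t) S') (t.substTy S')
  | betaQ {P Q t Q'} : Step (.qapp (.qabs P Q t) Q') (t.substQual Q')
  | upqual {P Q v p q} : ValueTag v Q → Q.eval = some q → P.eval = some p → q ≤ p →
      Step (.upqual P v) (v.retag P)
  | assertq {P Q v p q} : ValueTag v Q → Q.eval = some q → P.eval = some p → q ≤ p →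
      Step (.assertq P v) v
  | app₁ {s s' t} : Step s s' → Step (.app s t) (.app s' t)
  | app₂ {v t t'} : v.IsValue → Step t t' → Step (.app v t) (.app v t')
  | tapp {s s' S} : Step s s' → Step (.tapp s S) (.tapp s' S)
  | qapp {s s' Q} : Step s s' → Step (.qapp s Q) (.qapp s' Q)
  | upqualCongr {P s s'} : Step s s' → Step (.upqual P s) (.upqual P s')
  | assertqCongr {P s s'} : Step s s' → Step (.assertq P s) (.assertq P s')

end Reduction

end FsubQ

namespace FsubQ

universe u

/-! ### Algebra of renamings and substitutions -/

section Algebra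
variable {L : Type u}

-- Preservation goes by induction on the typing derivation, so that subsumption is immediate and
-- only the redexes need work. At a redex, inversion (`Typing.abs_inv`, `Typing.tabs_inv`,
-- `Typing.qabs_inv`) collapses all uses of subsumption on the abstraction into one subtyping from
-- its own type to the type at which it is used. Decomposing that subtyping and substituting the
-- argument into the body (`Typing.subst`) types the reduct. Retagging touches only the outermost
-- qualifier, which plays no part in the typing of the body (`Typing.retag`).
--
-- Inversion and substitution both need transitivity, which neither relation has as a general rule.
-- For qualifiers it is a cut elimination by induction on the middle expression (`Subqual.trans`); a
-- cut at a lattice element is already an instance of the evaluation rules.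
--
-- For types there is the usual circle of full F-sub: transitivity through `∀(X <: S). T` needs
-- narrowing of the bound `S`, and narrowing needs transitivity through `S`. It is broken by size.
-- If subtyping is transitive through all types of size below `n`, then bounds of size below `n` can
-- be narrowed, and this gives transitivity through types of size at most `n`
-- (`STy.Sub.trans_of_cutClass`, `cutClass_size_lt`). Narrowing is the identity substitution between
-- two environments, so one theorem, `STy.Sub.subst`, parametrised by the class of types through
-- which cuts are available, serves both inside this induction and, with the class of all types, for
-- type and qualifier application.

@[simp] theorem upRen_id : upRen id = id := by
  funext n; cases n <;> rfl

theorem upRen_comp (ξ ρ : ℕ → ℕ) : upRen (ξ ∘ ρ) = upRen ξ ∘ upRen ρ := by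
  funext n; cases n <;> rfl

@[simp] theorem upRen_zero (ρ : ℕ → ℕ) : upRen ρ 0 = 0 := rfl

@[simp] theorem upRen_succ (ρ : ℕ → ℕ) (n : ℕ) : upRen ρ (n + 1) = ρ n + 1 := rfl

@[simp] theorem upRen_comp_succ (ρ : ℕ → ℕ) : upRen ρ ∘ Nat.succ = Nat.succ ∘ ρ := rfl

theorem Qual.rename_rename (ξ ρ : ℕ → ℕ) (Q : Qual L) :
    (Q.rename ρ).rename ξ = Q.rename (ξ ∘ ρ) := by
  induction Q <;> simp_all [Qual.rename]

@[simp] theorem Qual.rename_id (Q : Qual L) : Q.rename id = Q := by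
  induction Q <;> simp_all [Qual.rename]

theorem Qual.rename_subst (ρ : ℕ → ℕ) (σ : ℕ → Qual L) (Q : Qual L) :
    (Q.rename ρ).subst σ = Q.subst (σ ∘ ρ) := by
  induction Q <;> simp_all [Qual.rename, Qual.subst]

theorem Qual.subst_rename (σ : ℕ → Qual L) (ρ : ℕ → ℕ) (Q : Qual L) :
    (Q.subst σ).rename ρ = Q.subst (fun n => (σ n).rename ρ) := by
  induction Q <;> simp_all [Qual.rename, Qual.subst]

theorem Qual.subst_subst (σ σ' : ℕ → Qual L) (Q : Qual L) :
    (Q.subst σ).subst σ' = Q.subst (fun n => (σ n).subst σ') := by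
  induction Q <;> simp_all [Qual.subst]

@[simp] theorem Qual.subst_var (Q : Qual L) : Q.subst Qual.var = Q := by
  induction Q <;> simp_all [Qual.subst]

@[simp] theorem Qual.up_succ (σ : ℕ → Qual L) (n : ℕ) :
    Qual.up σ (n + 1) = (σ n).rename Nat.succ := rfl

@[simp] theorem Qual.up_var : Qual.up (Qual.var : ℕ → Qual L) = Qual.var := by
  funext n; cases n <;> rfl

theorem Qual.up_comp (σ : ℕ → Qual L) (ρ : ℕ → ℕ) :
    Qual.up (σ ∘ ρ) = Qual.up σ ∘ upRen ρ := by
  funext n; cases n <;> rfl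

theorem Qual.up_rename (σ : ℕ → Qual L) (ρ : ℕ → ℕ) :
    Qual.up (fun n => (σ n).rename ρ) = fun n => (Qual.up σ n).rename (upRen ρ) := by
  funext n
  cases n
  · rfl
  · simp [Qual.rename_rename]

theorem Qual.subst_up_rename_succ (σ : ℕ → Qual L) (Q : Qual L) :
    (Q.rename Nat.succ).subst (Qual.up σ) = (Q.subst σ).rename Nat.succ := by
  rw [Qual.rename_subst, Qual.subst_rename]; rfl

/-- The binder case of the composition law for substitutions. The composition laws come in the order
renaming-renaming, renaming-substitution, substitution-renaming, substitution-substitution, because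
lifting under a binder is itself a renaming. -/
theorem Qual.up_subst (σ σ' : ℕ → Qual L) :
    Qual.up (fun n => (σ n).subst σ') = fun n => (Qual.up σ n).subst (Qual.up σ') := by
  funext n
  cases n
  · rfl
  · simp [Qual.subst_up_rename_succ]

theorem Qual.subst_single_rename_succ (Q R : Qual L) :
    (Q.rename Nat.succ).subst (Qual.single R) = Q := by
  rw [Qual.rename_subst]; exact Qual.subst_var Q

mutual
theorem STy.rename_rename (ξX ξY ρX ρY : ℕ → ℕ) : ∀ S : STy L,
    (S.rename ρX ρY).rename ξX ξY = S.rename (ξX ∘ ρX) (ξY ∘ ρY)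
  | .top => rfl
  | .var _ => rfl
  | .arrow T₁ T₂ => by
      simp [STy.rename, QTy.rename_rename ξX ξY ρX ρY T₁, QTy.rename_rename ξX ξY ρX ρY T₂]
  | .all S T => by
      simp [STy.rename, STy.rename_rename ξX ξY ρX ρY S,
        QTy.rename_rename (upRen ξX) ξY (upRen ρX) ρY T, upRen_comp]
  | .qall Q T => by
      simp [STy.rename, Qual.rename_rename,
        QTy.rename_rename ξX (upRen ξY) ρX (upRen ρY) T, upRen_comp]
theorem QTy.rename_rename (ξX ξY ρX ρY : ℕ → ℕ) : ∀ T : QTy L,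
    (T.rename ρX ρY).rename ξX ξY = T.rename (ξX ∘ ρX) (ξY ∘ ρY)
  | .mk Q S => by
      simp [QTy.rename, Qual.rename_rename, STy.rename_rename ξX ξY ρX ρY S]
end

mutual
@[simp] theorem STy.rename_id : ∀ S : STy L, S.rename id id = S
  | .top => rfl
  | .var _ => rfl
  | .arrow T₁ T₂ => by simp [STy.rename, QTy.rename_id T₁, QTy.rename_id T₂]
  | .all S T => by simp [STy.rename, STy.rename_id S, QTy.rename_id T]
  | .qall Q T => by simp [STy.rename, QTy.rename_id T]
@[simp] theorem QTy.rename_id : ∀ T : QTy L, T.rename id id = T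
  | .mk Q S => by simp [QTy.rename, STy.rename_id S]
end

@[simp] theorem STy.up_succ (τ : ℕ → STy L) (n : ℕ) :
    STy.up τ (n + 1) = (τ n).rename Nat.succ id := rfl

@[simp] theorem STy.up_var : STy.up (STy.var : ℕ → STy L) = STy.var := by
  funext n; cases n <;> rfl

theorem STy.up_comp (τ : ℕ → STy L) (ρ : ℕ → ℕ) :
    STy.up (τ ∘ ρ) = STy.up τ ∘ upRen ρ := by
  funext n; cases n <;> rfl

theorem STy.up_rename (τ : ℕ → STy L) (ρX ρY : ℕ → ℕ) :
    STy.up (fun n => (τ n).rename ρX ρY) = fun n => (STy.up τ n).rename (upRen ρX) ρY := by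
  funext n
  cases n
  · rfl
  · simp [STy.rename_rename]

mutual
theorem STy.rename_subst (ρX ρY : ℕ → ℕ) (τ : ℕ → STy L) (σ : ℕ → Qual L) : ∀ S : STy L,
    (S.rename ρX ρY).subst τ σ = S.subst (τ ∘ ρX) (σ ∘ ρY)
  | .top => rfl
  | .var _ => rfl
  | .arrow T₁ T₂ => by
      simp [STy.rename, STy.subst, QTy.rename_subst ρX ρY τ σ T₁, QTy.rename_subst ρX ρY τ σ T₂]
  | .all S T => by
      simp [STy.rename, STy.subst, STy.rename_subst ρX ρY τ σ S,
        QTy.rename_subst (upRen ρX) ρY (STy.up τ) σ T, STy.up_comp]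
  | .qall Q T => by
      simp only [STy.rename, STy.subst, Qual.rename_subst,
        QTy.rename_subst ρX (upRen ρY) (fun n => (τ n).rename id Nat.succ) (Qual.up σ) T,
        Qual.up_comp]
      rfl
theorem QTy.rename_subst (ρX ρY : ℕ → ℕ) (τ : ℕ → STy L) (σ : ℕ → Qual L) : ∀ T : QTy L,
    (T.rename ρX ρY).subst τ σ = T.subst (τ ∘ ρX) (σ ∘ ρY)
  | .mk Q S => by
      simp [QTy.rename, QTy.subst, Qual.rename_subst, STy.rename_subst ρX ρY τ σ S]
end

mutual
theorem STy.subst_rename (τ : ℕ → STy L) (σ : ℕ → Qual L) (ρX ρY : ℕ → ℕ) : ∀ S : STy L,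
    (S.subst τ σ).rename ρX ρY =
      S.subst (fun n => (τ n).rename ρX ρY) (fun n => (σ n).rename ρY)
  | .top => rfl
  | .var _ => rfl
  | .arrow T₁ T₂ => by
      simp [STy.rename, STy.subst, QTy.subst_rename τ σ ρX ρY T₁, QTy.subst_rename τ σ ρX ρY T₂]
  | .all S T => by
      simp [STy.rename, STy.subst, STy.subst_rename τ σ ρX ρY S,
        QTy.subst_rename (STy.up τ) σ (upRen ρX) ρY T, STy.up_rename]
  | .qall Q T => by
      simp [STy.rename, STy.subst, Qual.subst_rename, STy.rename_rename,
        QTy.subst_rename (fun n => (τ n).rename id Nat.succ) (Qual.up σ) ρX (upRen ρY) T,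
        Qual.up_rename]
theorem QTy.subst_rename (τ : ℕ → STy L) (σ : ℕ → Qual L) (ρX ρY : ℕ → ℕ) : ∀ T : QTy L,
    (T.subst τ σ).rename ρX ρY =
      T.subst (fun n => (τ n).rename ρX ρY) (fun n => (σ n).rename ρY)
  | .mk Q S => by
      simp [QTy.rename, QTy.subst, Qual.subst_rename, STy.subst_rename τ σ ρX ρY S]
end

theorem STy.subst_up_rename_succ (τ : ℕ → STy L) (σ : ℕ → Qual L) (S : STy L) :
    (S.rename Nat.succ id).subst (STy.up τ) σ = (S.subst τ σ).rename Nat.succ id := by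
  rw [STy.rename_subst, STy.subst_rename]; simp only [Qual.rename_id]; rfl

theorem QTy.subst_up_rename_succ (τ : ℕ → STy L) (σ : ℕ → Qual L) (T : QTy L) :
    (T.rename Nat.succ id).subst (STy.up τ) σ = (T.subst τ σ).rename Nat.succ id := by
  rw [QTy.rename_subst, QTy.subst_rename]; simp only [Qual.rename_id]; rfl

/-- Simple types contain qualifiers, so crossing a qualifier binder must also shift the images of
the type variables; this is the matching commutation with weakening. -/
theorem STy.subst_qup_rename_succ (τ : ℕ → STy L) (σ : ℕ → Qual L) (S : STy L) :
    (S.rename id Nat.succ).subst (fun n => (τ n).rename id Nat.succ) (Qual.up σ) =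
      (S.subst τ σ).rename id Nat.succ := by
  rw [STy.rename_subst, STy.subst_rename]; rfl

theorem QTy.subst_qup_rename_succ (τ : ℕ → STy L) (σ : ℕ → Qual L) (T : QTy L) :
    (T.rename id Nat.succ).subst (fun n => (τ n).rename id Nat.succ) (Qual.up σ) =
      (T.subst τ σ).rename id Nat.succ := by
  rw [QTy.rename_subst, QTy.subst_rename]; rfl

theorem STy.up_subst (τ τ' : ℕ → STy L) (σ' : ℕ → Qual L) :
    STy.up (fun n => (τ n).subst τ' σ') = fun n => (STy.up τ n).subst (STy.up τ') σ' := by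
  funext n
  cases n
  · rfl
  · simp [STy.subst_up_rename_succ]

mutual
theorem STy.subst_subst (τ τ' : ℕ → STy L) (σ σ' : ℕ → Qual L) : ∀ S : STy L,
    (S.subst τ σ).subst τ' σ' =
      S.subst (fun n => (τ n).subst τ' σ') (fun n => (σ n).subst σ')
  | .top => rfl
  | .var _ => rfl
  | .arrow T₁ T₂ => by
      simp [STy.subst, QTy.subst_subst τ τ' σ σ' T₁, QTy.subst_subst τ τ' σ σ' T₂]
  | .all S T => by
      simp [STy.subst, STy.subst_subst τ τ' σ σ' S,
        QTy.subst_subst (STy.up τ) (STy.up τ') σ σ' T, STy.up_subst]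
  | .qall Q T => by
      simp [STy.subst, Qual.subst_subst, STy.subst_qup_rename_succ,
        QTy.subst_subst (fun n => (τ n).rename id Nat.succ) (fun n => (τ' n).rename id Nat.succ)
          (Qual.up σ) (Qual.up σ') T, Qual.up_subst]
theorem QTy.subst_subst (τ τ' : ℕ → STy L) (σ σ' : ℕ → Qual L) : ∀ T : QTy L,
    (T.subst τ σ).subst τ' σ' =
      T.subst (fun n => (τ n).subst τ' σ') (fun n => (σ n).subst σ')
  | .mk Q S => by
      simp [QTy.subst, Qual.subst_subst, STy.subst_subst τ τ' σ σ' S]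
end

mutual
@[simp] theorem STy.subst_var : ∀ S : STy L, S.subst STy.var Qual.var = S
  | .top => rfl
  | .var _ => rfl
  | .arrow T₁ T₂ => by simp [STy.subst, QTy.subst_var T₁, QTy.subst_var T₂]
  | .all S T => by simp [STy.subst, STy.subst_var S, QTy.subst_var T]
  | .qall Q T => by simp [STy.subst, STy.rename, QTy.subst_var T]
@[simp] theorem QTy.subst_var : ∀ T : QTy L, T.subst STy.var Qual.var = T
  | .mk Q S => by simp [QTy.subst, STy.subst_var S]
end

theorem STy.subst_single_rename_succ (S U : STy L) :
    (S.rename Nat.succ id).subst (STy.single U) Qual.var = S := by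
  rw [STy.rename_subst]; exact STy.subst_var S

theorem QTy.subst_single_rename_succ (T : QTy L) (U : STy L) :
    (T.rename Nat.succ id).subst (STy.single U) Qual.var = T := by
  rw [QTy.rename_subst]; exact QTy.subst_var T

theorem STy.subst_qsingle_rename_succ (S : STy L) (R : Qual L) :
    (S.rename id Nat.succ).subst STy.var (Qual.single R) = S := by
  rw [STy.rename_subst]; exact STy.subst_var S

theorem QTy.subst_qsingle_rename_succ (T : QTy L) (R : Qual L) :
    (T.rename id Nat.succ).subst STy.var (Qual.single R) = T := by
  rw [QTy.rename_subst]; exact QTy.subst_var T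

theorem QTy.rename_substTy (ρX ρY : ℕ → ℕ) (T : QTy L) (S : STy L) :
    (T.substTy S).rename ρX ρY = (T.rename (upRen ρX) ρY).substTy (S.rename ρX ρY) := by
  simp only [QTy.substTy, QTy.subst_rename, QTy.rename_subst]
  congr 1
  funext n; cases n <;> rfl

theorem QTy.rename_substQual (ρX ρY : ℕ → ℕ) (T : QTy L) (Q : Qual L) :
    (T.substQual Q).rename ρX ρY = (T.rename ρX (upRen ρY)).substQual (Q.rename ρY) := by
  simp only [QTy.substQual, QTy.subst_rename, QTy.rename_subst]
  congr 1
  funext n; cases n <;> rfl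

/-- Needed because the type of a type application is itself a substitution instance. -/
theorem QTy.subst_substTy (τ : ℕ → STy L) (σ : ℕ → Qual L) (T : QTy L) (S : STy L) :
    (T.substTy S).subst τ σ = (T.subst (STy.up τ) σ).substTy (S.subst τ σ) := by
  simp only [QTy.substTy, QTy.subst_subst, Qual.subst_var]
  congr 1
  funext n
  cases n
  · rfl
  · simp [STy.single, STy.subst, STy.subst_single_rename_succ]

theorem QTy.subst_substQual (τ : ℕ → STy L) (σ : ℕ → Qual L) (T : QTy L) (Q : Qual L) :
    (T.substQual Q).subst τ σ =
      (T.subst (fun n => (τ n).rename id Nat.succ) (Qual.up σ)).substQual (Q.subst σ) := by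
  simp only [QTy.substQual, QTy.subst_subst]
  congr 1
  · funext n
    simp [STy.subst, STy.subst_qsingle_rename_succ]
  · funext n
    cases n
    · rfl
    · simp [Qual.single, Qual.subst, Qual.subst_single_rename_succ]

end Algebra

/-! ### Well-formedness -/

section WellFormedness
variable {L : Type u}

/-- `Y` is bound in `Γ`. -/
def Ctx.BindsQual (Γ : Ctx L) (Y : ℕ) : Prop := ∃ Q, HasQual Γ Y Q

/-- `X` is bound in `Γ`. -/
def Ctx.BindsTy (Γ : Ctx L) (X : ℕ) : Prop := ∃ S, HasTy Γ X S

theorem Ctx.bindsQual_qu_zero (Γ : Ctx L) (Q : Qual L) : (Ctx.qu Γ Q).BindsQual 0 :=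
  ⟨_, .here⟩

@[simp] theorem Ctx.bindsQual_qu_succ {Γ : Ctx L} {Q : Qual L} {Y : ℕ} :
    (Ctx.qu Γ Q).BindsQual (Y + 1) ↔ Γ.BindsQual Y :=
  ⟨fun ⟨_, h⟩ => by cases h with | qu h => exact ⟨_, h⟩, fun ⟨_, h⟩ => ⟨_, .qu h⟩⟩

@[simp] theorem Ctx.bindsQual_ty {Γ : Ctx L} {S : STy L} {Y : ℕ} :
    (Ctx.ty Γ S).BindsQual Y ↔ Γ.BindsQual Y :=
  ⟨fun ⟨_, h⟩ => by cases h with | ty h => exact ⟨_, h⟩, fun ⟨_, h⟩ => ⟨_, .ty h⟩⟩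

@[simp] theorem Ctx.bindsQual_tm {Γ : Ctx L} {T : QTy L} {Y : ℕ} :
    (Ctx.tm Γ T).BindsQual Y ↔ Γ.BindsQual Y :=
  ⟨fun ⟨_, h⟩ => by cases h with | tm h => exact ⟨_, h⟩, fun ⟨_, h⟩ => ⟨_, .tm h⟩⟩

theorem Ctx.bindsTy_ty_zero (Γ : Ctx L) (S : STy L) : (Ctx.ty Γ S).BindsTy 0 :=
  ⟨_, .here⟩

@[simp] theorem Ctx.bindsTy_ty_succ {Γ : Ctx L} {S : STy L} {X : ℕ} :
    (Ctx.ty Γ S).BindsTy (X + 1) ↔ Γ.BindsTy X :=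
  ⟨fun ⟨_, h⟩ => by cases h with | ty h => exact ⟨_, h⟩, fun ⟨_, h⟩ => ⟨_, .ty h⟩⟩

@[simp] theorem Ctx.bindsTy_qu {Γ : Ctx L} {Q : Qual L} {X : ℕ} :
    (Ctx.qu Γ Q).BindsTy X ↔ Γ.BindsTy X :=
  ⟨fun ⟨_, h⟩ => by cases h with | qu h => exact ⟨_, h⟩, fun ⟨_, h⟩ => ⟨_, .qu h⟩⟩

@[simp] theorem Ctx.bindsTy_tm {Γ : Ctx L} {T : QTy L} {X : ℕ} :
    (Ctx.tm Γ T).BindsTy X ↔ Γ.BindsTy X :=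
  ⟨fun ⟨_, h⟩ => by cases h with | tm h => exact ⟨_, h⟩, fun ⟨_, h⟩ => ⟨_, .tm h⟩⟩

theorem STy.wf_var {Γ : Ctx L} {X : ℕ} : (STy.var X).WF Γ ↔ Γ.BindsTy X := by
  simp [STy.WF, Ctx.BindsTy]

theorem Qual.WF.rename {Γ Δ : Ctx L} {ρ : ℕ → ℕ}
    (hY : ∀ Y, Γ.BindsQual Y → Δ.BindsQual (ρ Y)) {Q : Qual L} (h : Q.WF Γ) :
    (Q.rename ρ).WF Δ := by
  induction Q with
  | base => trivial
  | var Y => exact hY Y h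
  | meet _ _ ih₁ ih₂ => exact ⟨ih₁ h.1, ih₂ h.2⟩
  | join _ _ ih₁ ih₂ => exact ⟨ih₁ h.1, ih₂ h.2⟩

theorem Qual.WF.subst {Γ Δ : Ctx L} {σ : ℕ → Qual L}
    (hY : ∀ Y, Γ.BindsQual Y → (σ Y).WF Δ) {Q : Qual L} (h : Q.WF Γ) :
    (Q.subst σ).WF Δ := by
  induction Q with
  | base => trivial
  | var Y => exact hY Y h
  | meet _ _ ih₁ ih₂ => exact ⟨ih₁ h.1, ih₂ h.2⟩
  | join _ _ ih₁ ih₂ => exact ⟨ih₁ h.1, ih₂ h.2⟩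

theorem bindsTy_upRen {Γ Δ : Ctx L} {ρ : ℕ → ℕ} (hX : ∀ X, Γ.BindsTy X → Δ.BindsTy (ρ X))
    (S U : STy L) : ∀ X, (Ctx.ty Γ S).BindsTy X → (Ctx.ty Δ U).BindsTy (upRen ρ X)
  | 0, _ => Ctx.bindsTy_ty_zero _ _
  | X + 1, h => Ctx.bindsTy_ty_succ.2 (hX X (Ctx.bindsTy_ty_succ.1 h))

theorem bindsQual_upRen {Γ Δ : Ctx L} {ρ : ℕ → ℕ} (hY : ∀ Y, Γ.BindsQual Y → Δ.BindsQual (ρ Y))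
    (Q R : Qual L) : ∀ Y, (Ctx.qu Γ Q).BindsQual Y → (Ctx.qu Δ R).BindsQual (upRen ρ Y)
  | 0, _ => Ctx.bindsQual_qu_zero _ _
  | Y + 1, h => Ctx.bindsQual_qu_succ.2 (hY Y (Ctx.bindsQual_qu_succ.1 h))

mutual
theorem STy.WF.rename {Γ Δ : Ctx L} {ρX ρY : ℕ → ℕ}
    (hX : ∀ X, Γ.BindsTy X → Δ.BindsTy (ρX X))
    (hY : ∀ Y, Γ.BindsQual Y → Δ.BindsQual (ρY Y)) :
    ∀ {S : STy L}, S.WF Γ → (S.rename ρX ρY).WF Δ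
  | .top, _ => by simp [STy.rename, STy.WF]
  | .var X, h => by
      simp only [STy.rename, STy.WF] at h ⊢
      exact hX X h
  | .arrow T₁ T₂, h => by
      simp only [STy.rename, STy.WF] at h ⊢
      exact ⟨QTy.WF.rename hX hY h.1, QTy.WF.rename hX hY h.2⟩
  | .all S T, h => by
      simp only [STy.rename, STy.WF] at h ⊢
      exact ⟨STy.WF.rename hX hY h.1,
        QTy.WF.rename (bindsTy_upRen hX _ _) (by simpa using hY) h.2⟩
  | .qall Q T, h => by
      simp only [STy.rename, STy.WF] at h ⊢
      exact ⟨h.1.rename hY,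
        QTy.WF.rename (by simpa using hX) (bindsQual_upRen hY _ _) h.2⟩
theorem QTy.WF.rename {Γ Δ : Ctx L} {ρX ρY : ℕ → ℕ}
    (hX : ∀ X, Γ.BindsTy X → Δ.BindsTy (ρX X))
    (hY : ∀ Y, Γ.BindsQual Y → Δ.BindsQual (ρY Y)) :
    ∀ {T : QTy L}, T.WF Γ → (T.rename ρX ρY).WF Δ
  | .mk Q S, h => by
      simp only [QTy.rename, QTy.WF] at h ⊢
      exact ⟨h.1.rename hY, STy.WF.rename hX hY h.2⟩
end

theorem QTy.WF.mono {Γ Δ : Ctx L} (hX : ∀ X, Γ.BindsTy X → Δ.BindsTy X)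
    (hY : ∀ Y, Γ.BindsQual Y → Δ.BindsQual Y) {T : QTy L} (h : T.WF Γ) : T.WF Δ := by
  simpa using QTy.WF.rename (ρX := id) (ρY := id) hX hY h

/-- The subtyping rule for `∀` compares both bodies under the smaller bound, whereas the left type
is well formed under its own bound. -/
theorem QTy.WF.change_ty {Γ : Ctx L} {S U : STy L} {T : QTy L} (h : T.WF (.ty Γ S)) :
    T.WF (.ty Γ U) := by
  simpa using QTy.WF.rename (bindsTy_upRen (ρ := id) (fun _ => id) S U) (ρY := id)
    (by simp) h

theorem QTy.WF.change_qu {Γ : Ctx L} {Q R : Qual L} {T : QTy L} (h : T.WF (.qu Γ Q)) :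
    T.WF (.qu Γ R) := by
  simpa using QTy.WF.rename (ρX := id) (by simp)
    (bindsQual_upRen (ρ := id) (fun _ => id) Q R) h

theorem Qual.WF.weaken_qu {Γ : Ctx L} {Q R : Qual L} (h : Q.WF Γ) :
    (Q.rename Nat.succ).WF (.qu Γ R) := h.rename (by simp)

theorem Qual.WF.weaken_ty {Γ : Ctx L} {Q : Qual L} {S : STy L} (h : Q.WF Γ) :
    Q.WF (.ty Γ S) := by
  simpa using h.rename (Δ := .ty Γ S) (ρ := id) (by simp)

theorem Qual.WF.weaken_tm {Γ : Ctx L} {Q : Qual L} {T : QTy L} (h : Q.WF Γ) :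
    Q.WF (.tm Γ T) := by
  simpa using h.rename (Δ := .tm Γ T) (ρ := id) (by simp)

theorem STy.WF.weaken_qu {Γ : Ctx L} {S : STy L} {R : Qual L} (h : S.WF Γ) :
    (S.rename id Nat.succ).WF (.qu Γ R) := h.rename (by simp) (by simp)

theorem STy.WF.weaken_ty {Γ : Ctx L} {S U : STy L} (h : S.WF Γ) :
    (S.rename Nat.succ id).WF (.ty Γ U) := h.rename (by simp) (by simp)

theorem QTy.WF.weaken_qu {Γ : Ctx L} {T : QTy L} {R : Qual L} (h : T.WF Γ) :
    (T.rename id Nat.succ).WF (.qu Γ R) := h.rename (by simp) (by simp)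

theorem QTy.WF.weaken_ty {Γ : Ctx L} {T : QTy L} {U : STy L} (h : T.WF Γ) :
    (T.rename Nat.succ id).WF (.ty Γ U) := h.rename (by simp) (by simp)

theorem QTy.WF.weaken_tm {Γ : Ctx L} {T U : QTy L} (h : T.WF Γ) :
    T.WF (.tm Γ U) := h.mono (by simp) (by simp)

/-- Types never mention term variables, so the result type of a function makes sense outside its
body. -/
theorem QTy.WF.strengthen_tm {Γ : Ctx L} {T U : QTy L} (h : T.WF (.tm Γ U)) : T.WF Γ :=
  h.mono (by simp) (by simp)

theorem STy.up_wf {Γ Δ : Ctx L} {τ : ℕ → STy L} (hX : ∀ X, Γ.BindsTy X → (τ X).WF Δ)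
    (S U : STy L) : ∀ X, (Ctx.ty Γ S).BindsTy X → (STy.up τ X).WF (.ty Δ U)
  | 0, _ => STy.wf_var.2 (Ctx.bindsTy_ty_zero Δ U)
  | X + 1, h => (hX X (Ctx.bindsTy_ty_succ.1 h)).weaken_ty

theorem Qual.up_wf {Γ Δ : Ctx L} {σ : ℕ → Qual L} (hY : ∀ Y, Γ.BindsQual Y → (σ Y).WF Δ)
    (Q R : Qual L) : ∀ Y, (Ctx.qu Γ Q).BindsQual Y → (Qual.up σ Y).WF (.qu Δ R)
  | 0, _ => Ctx.bindsQual_qu_zero Δ R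
  | Y + 1, h => (hY Y (Ctx.bindsQual_qu_succ.1 h)).weaken_qu

mutual
theorem STy.WF.subst {Γ Δ : Ctx L} {τ : ℕ → STy L} {σ : ℕ → Qual L}
    (hX : ∀ X, Γ.BindsTy X → (τ X).WF Δ) (hY : ∀ Y, Γ.BindsQual Y → (σ Y).WF Δ) :
    ∀ {S : STy L}, S.WF Γ → (S.subst τ σ).WF Δ
  | .top, _ => by simp [STy.subst, STy.WF]
  | .var X, h => by
      simp only [STy.subst, STy.WF] at h ⊢
      exact hX X h
  | .arrow T₁ T₂, h => by
      simp only [STy.subst, STy.WF] at h ⊢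
      exact ⟨QTy.WF.subst hX hY h.1, QTy.WF.subst hX hY h.2⟩
  | .all S T, h => by
      simp only [STy.subst, STy.WF] at h ⊢
      exact ⟨STy.WF.subst hX hY h.1, QTy.WF.subst (STy.up_wf hX _ _)
        (fun Y hb => (hY Y (Ctx.bindsQual_ty.1 hb)).weaken_ty) h.2⟩
  | .qall Q T, h => by
      simp only [STy.subst, STy.WF] at h ⊢
      exact ⟨h.1.subst hY, QTy.WF.subst
        (fun X hb => (hX X (Ctx.bindsTy_qu.1 hb)).weaken_qu) (Qual.up_wf hY _ _) h.2⟩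
theorem QTy.WF.subst {Γ Δ : Ctx L} {τ : ℕ → STy L} {σ : ℕ → Qual L}
    (hX : ∀ X, Γ.BindsTy X → (τ X).WF Δ) (hY : ∀ Y, Γ.BindsQual Y → (σ Y).WF Δ) :
    ∀ {T : QTy L}, T.WF Γ → (T.subst τ σ).WF Δ
  | .mk Q S, h => by
      simp only [QTy.subst, QTy.WF] at h ⊢
      exact ⟨h.1.subst hY, STy.WF.subst hX hY h.2⟩
end

theorem QTy.WF.substTy {Γ : Ctx L} {S U : STy L} {T : QTy L} (hT : T.WF (.ty Γ U))
    (hS : S.WF Γ) : (T.substTy S).WF Γ := by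
  refine QTy.WF.subst (fun X hX => ?_) (fun Y hY => ?_) hT
  rotate_left
  · exact Ctx.bindsQual_ty.1 hY
  cases X with
  | zero => exact hS
  | succ X => exact STy.wf_var.2 (Ctx.bindsTy_ty_succ.1 hX)

theorem QTy.WF.substQual {Γ : Ctx L} {Q R : Qual L} {T : QTy L} (hT : T.WF (.qu Γ R))
    (hQ : Q.WF Γ) : (T.substQual Q).WF Γ := by
  refine QTy.WF.subst (fun X hX => ?_) (fun Y hY => ?_) hT
  · exact STy.wf_var.2 (Ctx.bindsTy_qu.1 hX)
  · cases Y with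
    | zero => exact hQ
    | succ Y => exact Ctx.bindsQual_qu_succ.1 hY

theorem HasQual.wf {Γ : Ctx L} {Y : ℕ} {Q : Qual L} (h : HasQual Γ Y Q) (hΓ : Γ.WF) :
    Q.WF Γ := by
  induction h with
  | here => exact hΓ.2.weaken_qu
  | qu _ ih => exact (ih hΓ.1).weaken_qu
  | ty _ ih => exact (ih hΓ.1).weaken_ty
  | tm _ ih => exact (ih hΓ.1).weaken_tm

theorem HasTerm.wf {Γ : Ctx L} {x : ℕ} {T : QTy L} (h : HasTerm Γ x T) (hΓ : Γ.WF) :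
    T.WF Γ := by
  induction h with
  | here => exact hΓ.2.weaken_tm
  | qu _ ih => exact (ih hΓ.1).weaken_qu
  | ty _ ih => exact (ih hΓ.1).weaken_ty
  | tm _ ih => exact (ih hΓ.1).weaken_tm

end WellFormedness

/-! ### Subqualification -/

section Subqualification
variable {L : Type u} [Lattice L]

/-- An expression with a value contains no variables. Hence the evaluation rules survive
substitution. -/
theorem Qual.eval_subst (σ : ℕ → Qual L) :
    ∀ {Q : Qual L} {l : L}, Q.eval = some l → (Q.subst σ).eval = some l
  | .base _, _, h => h
  | .meet Q R, l, h => by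
      simp only [Qual.subst, Qual.eval, Option.bind_eq_some_iff] at h ⊢
      obtain ⟨a, ha, b, hb, e⟩ := h
      exact ⟨a, Qual.eval_subst σ ha, b, Qual.eval_subst σ hb, e⟩
  | .join Q R, l, h => by
      simp only [Qual.subst, Qual.eval, Option.bind_eq_some_iff] at h ⊢
      obtain ⟨a, ha, b, hb, e⟩ := h
      exact ⟨a, Qual.eval_subst σ ha, b, Qual.eval_subst σ hb, e⟩

theorem Qual.eval_rename (ρ : ℕ → ℕ) :
    ∀ {Q : Qual L} {l : L}, Q.eval = some l → (Q.rename ρ).eval = some l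
  | .base _, _, h => h
  | .meet Q R, l, h => by
      simp only [Qual.rename, Qual.eval, Option.bind_eq_some_iff] at h ⊢
      obtain ⟨a, ha, b, hb, e⟩ := h
      exact ⟨a, Qual.eval_rename ρ ha, b, Qual.eval_rename ρ hb, e⟩
  | .join Q R, l, h => by
      simp only [Qual.rename, Qual.eval, Option.bind_eq_some_iff] at h ⊢
      obtain ⟨a, ha, b, hb, e⟩ := h
      exact ⟨a, Qual.eval_rename ρ ha, b, Qual.eval_rename ρ hb, e⟩

variable [BoundedOrder L]

theorem Subqual.wf {Γ : Ctx L} {Q R : Qual L} (h : Subqual Γ Q R) :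
    Γ.WF ∧ Q.WF Γ ∧ R.WF Γ := by
  induction h with
  | top hΓ hQ => exact ⟨hΓ, hQ, trivial⟩
  | bot hΓ hQ => exact ⟨hΓ, trivial, hQ⟩
  | reflVar hΓ hY => exact ⟨hΓ, hY, hY⟩
  | var hY _ ih => exact ⟨ih.1, ⟨_, hY⟩, ih.2.2⟩
  | joinIntro₁ _ hR ih => exact ⟨ih.1, ih.2.1, ih.2.2, hR⟩
  | joinIntro₂ hR _ ih => exact ⟨ih.1, ih.2.1, hR, ih.2.2⟩
  | joinElim _ _ ih₁ ih₂ => exact ⟨ih₁.1, ⟨ih₁.2.1, ih₂.2.1⟩, ih₁.2.2⟩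
  | meetIntro _ _ ih₁ ih₂ => exact ⟨ih₁.1, ih₁.2.1, ih₁.2.2, ih₂.2.2⟩
  | meetElim₁ _ hQ ih => exact ⟨ih.1, ⟨ih.2.1, hQ⟩, ih.2.2⟩
  | meetElim₂ hQ _ ih => exact ⟨ih.1, ⟨hQ, ih.2.1⟩, ih.2.2⟩
  | lift hΓ _ => exact ⟨hΓ, trivial, trivial⟩
  | evalElim _ _ _ ih₁ ih₂ => exact ⟨ih₁.1, ih₁.2.1, ih₂.2.2⟩
  | evalIntro _ _ _ ih₁ ih₂ => exact ⟨ih₁.1, ih₁.2.1, ih₂.2.2⟩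

theorem Subqual.refl {Γ : Ctx L} (hΓ : Γ.WF) {Q : Qual L} (hQ : Q.WF Γ) : Subqual Γ Q Q := by
  induction Q with
  | base l => exact .lift hΓ le_rfl
  | var Y => exact .reflVar hΓ hQ
  | meet Q R ih₁ ih₂ =>
    exact .meetIntro (.meetElim₁ (ih₁ hQ.1) hQ.2) (.meetElim₂ hQ.1 (ih₂ hQ.2))
  | join Q R ih₁ ih₂ =>
    exact .joinElim (.joinIntro₁ (ih₁ hQ.1) hQ.2) (.joinIntro₂ hQ.1 (ih₂ hQ.2))

/-- Join elimination on the left is invertible. Every other rule applicable to a join on the left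
either acts on the right-hand side or, for the evaluation rules, keeps the join on the left of its
first premise, so the inversion passes through it. -/
theorem Subqual.of_join {Γ : Ctx L} {Q Q₁ Q₂ R : Qual L} (h : Subqual Γ Q R)
    (e : Q = .join Q₁ Q₂) : Subqual Γ Q₁ R ∧ Subqual Γ Q₂ R := by
  induction h with
  | top hΓ hQ => subst e; exact ⟨.top hΓ hQ.1, .top hΓ hQ.2⟩
  | joinIntro₁ _ hR ih => exact ⟨.joinIntro₁ (ih e).1 hR, .joinIntro₁ (ih e).2 hR⟩
  | joinIntro₂ hR _ ih => exact ⟨.joinIntro₂ hR (ih e).1, .joinIntro₂ hR (ih e).2⟩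
  | joinElim h₁ h₂ => cases e; exact ⟨h₁, h₂⟩
  | meetIntro _ _ ih₁ ih₂ =>
    exact ⟨.meetIntro (ih₁ e).1 (ih₂ e).1, .meetIntro (ih₁ e).2 (ih₂ e).2⟩
  | evalElim _ hM h ih => exact ⟨.evalElim (ih e).1 hM h, .evalElim (ih e).2 hM h⟩
  | evalIntro _ hM h ih => exact ⟨.evalIntro (ih e).1 hM h, .evalIntro (ih e).2 hM h⟩
  | _ => cases e

theorem Subqual.of_meet {Γ : Ctx L} {Q R R₁ R₂ : Qual L} (h : Subqual Γ Q R)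
    (e : R = .meet R₁ R₂) : Subqual Γ Q R₁ ∧ Subqual Γ Q R₂ := by
  induction h with
  | bot hΓ hQ => subst e; exact ⟨.bot hΓ hQ.1, .bot hΓ hQ.2⟩
  | var hY _ ih => exact ⟨.var hY (ih e).1, .var hY (ih e).2⟩
  | meetIntro h₁ h₂ => cases e; exact ⟨h₁, h₂⟩
  | joinElim _ _ ih₁ ih₂ =>
    exact ⟨.joinElim (ih₁ e).1 (ih₂ e).1, .joinElim (ih₁ e).2 (ih₂ e).2⟩
  | meetElim₁ _ hQ ih => exact ⟨.meetElim₁ (ih e).1 hQ, .meetElim₁ (ih e).2 hQ⟩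
  | meetElim₂ hQ _ ih => exact ⟨.meetElim₂ hQ (ih e).1, .meetElim₂ hQ (ih e).2⟩
  | evalElim h hM _ _ ih => exact ⟨.evalElim h hM (ih e).1, .evalElim h hM (ih e).2⟩
  | evalIntro h hM _ _ ih => exact ⟨.evalIntro h hM (ih e).1, .evalIntro h hM (ih e).2⟩
  | _ => cases e

/-- Induction on the cut expression, with an inner induction on the derivation whose matching rule
involves a choice: the first one for a join, the second one for a meet. The other derivation is then
inverted by `of_join` or `of_meet`, and the cut moves to a component. -/
theorem Subqual.trans {Γ : Ctx L} {Q M R : Qual L} (h₁ : Subqual Γ Q M)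
    (h₂ : Subqual Γ M R) : Subqual Γ Q R := by
  induction M generalizing Q R with
  -- With `M` the lattice element itself, the evaluation rule is exactly a cut at that element.
  | base l => exact .evalIntro h₁ rfl h₂
  | var Y =>
    generalize e : Qual.var Y = M at h₁
    induction h₁ with
    | bot hΓ _ => exact .bot hΓ h₂.wf.2.2
    | reflVar => cases e; exact h₂
    | var hY _ ih => exact .var hY (ih e)
    | joinElim _ _ ih₁ ih₂ => exact .joinElim (ih₁ e) (ih₂ e)
    | meetElim₁ _ hQ ih => exact .meetElim₁ (ih e) hQ
    | meetElim₂ hQ _ ih => exact .meetElim₂ hQ (ih e)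
    | evalElim h hM _ _ ih => exact .evalElim h hM (ih e)
    | evalIntro h hM _ _ ih => exact .evalIntro h hM (ih e)
    | _ => cases e
  | join M₁ M₂ ihM₁ ihM₂ =>
    generalize e : Qual.join M₁ M₂ = M at h₁
    induction h₁ with
    | bot hΓ _ => exact .bot hΓ h₂.wf.2.2
    | joinIntro₁ h => cases e; exact ihM₁ h (h₂.of_join rfl).1
    | joinIntro₂ _ h => cases e; exact ihM₂ h (h₂.of_join rfl).2
    | var hY _ ih => exact .var hY (ih e)
    | joinElim _ _ ih₁ ih₂ => exact .joinElim (ih₁ e) (ih₂ e)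
    | meetElim₁ _ hQ ih => exact .meetElim₁ (ih e) hQ
    | meetElim₂ hQ _ ih => exact .meetElim₂ hQ (ih e)
    | evalElim h hM _ _ ih => exact .evalElim h hM (ih e)
    | evalIntro h hM _ _ ih => exact .evalIntro h hM (ih e)
    | _ => cases e
  | meet M₁ M₂ ihM₁ ihM₂ =>
    generalize e : Qual.meet M₁ M₂ = M at h₂
    induction h₂ with
    | top hΓ _ => exact .top hΓ h₁.wf.2.1
    | joinIntro₁ _ hR ih => exact .joinIntro₁ (ih e) hR
    | joinIntro₂ hR _ ih => exact .joinIntro₂ hR (ih e)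
    | meetIntro _ _ ih₁ ih₂ => exact .meetIntro (ih₁ e) (ih₂ e)
    | meetElim₁ h => cases e; exact ihM₁ (h₁.of_meet rfl).1 h
    | meetElim₂ _ h => cases e; exact ihM₂ (h₁.of_meet rfl).2 h
    | evalElim _ hM h ih => exact .evalElim (ih e) hM h
    | evalIntro _ hM h ih => exact .evalIntro (ih e) hM h
    | _ => cases e

end Subqualification

/-! ### Renaming of subqualifications -/

section Renaming
variable {L : Type u}

/-- The renaming `ρX`, `ρY` maps the bindings of `Γ` to bindings of the well-formed `Δ`. -/
structure RenHom (Γ Δ : Ctx L) (ρX ρY : ℕ → ℕ) : Prop where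
  wf : Δ.WF
  qual : ∀ {Y Q}, HasQual Γ Y Q → HasQual Δ (ρY Y) (Q.rename ρY)
  ty : ∀ {X S}, HasTy Γ X S → HasTy Δ (ρX X) (S.rename ρX ρY)

namespace RenHom
variable {Γ Δ : Ctx L} {ρX ρY : ℕ → ℕ}

theorem bindsQual (h : RenHom Γ Δ ρX ρY) (Y : ℕ) : Γ.BindsQual Y → Δ.BindsQual (ρY Y) :=
  fun ⟨_, hY⟩ => ⟨_, h.qual hY⟩

theorem bindsTy (h : RenHom Γ Δ ρX ρY) (X : ℕ) : Γ.BindsTy X → Δ.BindsTy (ρX X) :=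
  fun ⟨_, hX⟩ => ⟨_, h.ty hX⟩

theorem up_ty (h : RenHom Γ Δ ρX ρY) {S : STy L} (hS : (S.rename ρX ρY).WF Δ) :
    RenHom (.ty Γ S) (.ty Δ (S.rename ρX ρY)) (upRen ρX) ρY where
  wf := ⟨h.wf, hS⟩
  qual hY := by cases hY with | ty hY => exact .ty (h.qual hY)
  ty {X U} hX := by
    cases hX with
    | here =>
      have := HasTy.here (Γ := Δ) (S := S.rename ρX ρY)
      simpa [STy.rename_rename] using this
    | @ty _ X U _ hX =>
      have := (h.ty hX).ty (U := S.rename ρX ρY)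
      simpa [STy.rename_rename] using this

theorem up_qu (h : RenHom Γ Δ ρX ρY) {Q : Qual L} (hQ : (Q.rename ρY).WF Δ) :
    RenHom (.qu Γ Q) (.qu Δ (Q.rename ρY)) ρX (upRen ρY) where
  wf := ⟨h.wf, hQ⟩
  ty {X U} hX := by
    cases hX with
    | qu hX =>
      have := (h.ty hX).qu (R := Q.rename ρY)
      simpa [STy.rename_rename] using this
  qual {Y U} hY := by
    cases hY with
    | here =>
      have := HasQual.here (Γ := Δ) (Q := Q.rename ρY)
      simpa [Qual.rename_rename] using this
    | qu hY =>
      have := (h.qual hY).qu (R := Q.rename ρY)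
      simpa [Qual.rename_rename] using this

theorem up_tm (h : RenHom Γ Δ ρX ρY) {T : QTy L} (hT : (T.rename ρX ρY).WF Δ) :
    RenHom (.tm Γ T) (.tm Δ (T.rename ρX ρY)) ρX ρY where
  wf := ⟨h.wf, hT⟩
  qual hY := by cases hY with | tm hY => exact .tm (h.qual hY)
  ty hX := by cases hX with | tm hX => exact .tm (h.ty hX)

theorem weaken_ty {S : STy L} (hΓ : (Ctx.ty Γ S).WF) : RenHom Γ (.ty Γ S) Nat.succ id where
  wf := hΓ
  qual hY := by simpa using hY.ty
  ty hX := hX.ty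

theorem weaken_qu {Q : Qual L} (hΓ : (Ctx.qu Γ Q).WF) : RenHom Γ (.qu Γ Q) id Nat.succ where
  wf := hΓ
  qual hY := hY.qu
  ty hX := hX.qu

theorem weaken_tm {T : QTy L} (hΓ : (Ctx.tm Γ T).WF) : RenHom Γ (.tm Γ T) id id where
  wf := hΓ
  qual hY := by simpa using hY.tm
  ty hX := by simpa using hX.tm

end RenHom

variable [Lattice L] [BoundedOrder L]

theorem Subqual.rename {Γ Δ : Ctx L} {ρX ρY : ℕ → ℕ} (hρ : RenHom Γ Δ ρX ρY) {Q R : Qual L}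
    (h : Subqual Γ Q R) : Subqual Δ (Q.rename ρY) (R.rename ρY) := by
  induction h with
  | top _ hQ => exact .top hρ.wf (hQ.rename hρ.bindsQual)
  | bot _ hQ => exact .bot hρ.wf (hQ.rename hρ.bindsQual)
  | reflVar _ hY => exact .reflVar hρ.wf (hρ.bindsQual _ hY)
  | var hY _ ih => exact .var (hρ.qual hY) ih
  | joinIntro₁ _ hR ih => exact .joinIntro₁ ih (hR.rename hρ.bindsQual)
  | joinIntro₂ hR _ ih => exact .joinIntro₂ (hR.rename hρ.bindsQual) ih
  | joinElim _ _ ih₁ ih₂ => exact .joinElim ih₁ ih₂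
  | meetIntro _ _ ih₁ ih₂ => exact .meetIntro ih₁ ih₂
  | meetElim₁ _ hQ ih => exact .meetElim₁ ih (hQ.rename hρ.bindsQual)
  | meetElim₂ hQ _ ih => exact .meetElim₂ (hQ.rename hρ.bindsQual) ih
  | lift _ hl => exact .lift hρ.wf hl
  | evalElim _ hM _ ih₁ ih₂ => exact .evalElim ih₁ (Qual.eval_rename ρY hM) ih₂
  | evalIntro _ hM _ ih₁ ih₂ => exact .evalIntro ih₁ (Qual.eval_rename ρY hM) ih₂

/-- The variable rules become reflexivity and transitivity at arbitrary qualifiers; all other rules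
are preserved literally. -/
theorem Subqual.subst {Γ Δ : Ctx L} {σ : ℕ → Qual L} (hΔ : Δ.WF)
    (hσ : ∀ {Y Q}, HasQual Γ Y Q → Subqual Δ (σ Y) (Q.subst σ)) {Q R : Qual L}
    (h : Subqual Γ Q R) : Subqual Δ (Q.subst σ) (R.subst σ) := by
  have hb : ∀ Y, Γ.BindsQual Y → (σ Y).WF Δ := fun Y ⟨_, hY⟩ => (hσ hY).wf.2.1
  induction h with
  | top _ hQ => exact .top hΔ (hQ.subst hb)
  | bot _ hQ => exact .bot hΔ (hQ.subst hb)
  | reflVar _ hY => exact .refl hΔ (hb _ hY)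
  | var hY _ ih => exact (hσ hY).trans ih
  | joinIntro₁ _ hR ih => exact .joinIntro₁ ih (hR.subst hb)
  | joinIntro₂ hR _ ih => exact .joinIntro₂ (hR.subst hb) ih
  | joinElim _ _ ih₁ ih₂ => exact .joinElim ih₁ ih₂
  | meetIntro _ _ ih₁ ih₂ => exact .meetIntro ih₁ ih₂
  | meetElim₁ _ hQ ih => exact .meetElim₁ ih (hQ.subst hb)
  | meetElim₂ hQ _ ih => exact .meetElim₂ (hQ.subst hb) ih
  | lift _ hl => exact .lift hΔ hl
  | evalElim _ hM _ ih₁ ih₂ => exact .evalElim ih₁ (Qual.eval_subst σ hM) ih₂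
  | evalIntro _ hM _ ih₁ ih₂ => exact .evalIntro ih₁ (Qual.eval_subst σ hM) ih₂

end Renaming

/-! ### Subtyping -/

section Subtyping
variable {L : Type u}

theorem STy.wf_top {Γ : Ctx L} : (STy.top : STy L).WF Γ := by simp [STy.WF]

theorem STy.wf_arrow {Γ : Ctx L} {T₁ T₂ : QTy L} :
    (STy.arrow T₁ T₂).WF Γ ↔ T₁.WF Γ ∧ T₂.WF Γ := by simp [STy.WF]

theorem STy.wf_all {Γ : Ctx L} {S : STy L} {T : QTy L} :
    (STy.all S T).WF Γ ↔ S.WF Γ ∧ T.WF (.ty Γ S) := by simp [STy.WF]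

theorem STy.wf_qall {Γ : Ctx L} {Q : Qual L} {T : QTy L} :
    (STy.qall Q T).WF Γ ↔ Q.WF Γ ∧ T.WF (.qu Γ Q) := by simp [STy.WF]

theorem QTy.wf_mk {Γ : Ctx L} {Q : Qual L} {S : STy L} :
    (QTy.mk Q S).WF Γ ↔ Q.WF Γ ∧ S.WF Γ := by simp [QTy.WF]

mutual
/-- The number of type formers other than qualification. -/
def STy.size : STy L → ℕ
  | .top => 1
  | .var _ => 1
  | .arrow T₁ T₂ => T₁.size + T₂.size + 1
  | .all S T => S.size + T.size + 1
  | .qall _ T => T.size + 1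
/-- The number of type formers other than qualification. -/
def QTy.size : QTy L → ℕ
  | .mk _ S => S.size
end

mutual
theorem STy.size_rename (ρX ρY : ℕ → ℕ) : ∀ S : STy L, (S.rename ρX ρY).size = S.size
  | .top => rfl
  | .var _ => rfl
  | .arrow T₁ T₂ => by simp [STy.rename, STy.size, QTy.size_rename ρX ρY]
  | .all S T => by
      simp [STy.rename, STy.size, STy.size_rename ρX ρY S, QTy.size_rename (upRen ρX) ρY T]
  | .qall Q T => by simp [STy.rename, STy.size, QTy.size_rename ρX (upRen ρY) T]
theorem QTy.size_rename (ρX ρY : ℕ → ℕ) : ∀ T : QTy L, (T.rename ρX ρY).size = T.size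
  | .mk Q S => by simp [QTy.rename, QTy.size, STy.size_rename ρX ρY S]
end

variable [Lattice L] [BoundedOrder L]

mutual
theorem STy.Sub.wf : ∀ {Γ : Ctx L} {S U : STy L}, STy.Sub Γ S U → Γ.WF ∧ S.WF Γ ∧ U.WF Γ
  | _, _, _, .top hΓ hS => ⟨hΓ, hS, STy.wf_top⟩
  | _, _, _, .reflVar hΓ hX => ⟨hΓ, hX, hX⟩
  | _, _, _, .var hX h => ⟨h.wf.1, STy.wf_var.2 ⟨_, hX⟩, h.wf.2.2⟩
  | _, _, _, .arrow h₁ h₂ =>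
    ⟨h₁.wf.1, STy.wf_arrow.2 ⟨h₁.wf.2.2, h₂.wf.2.1⟩, STy.wf_arrow.2 ⟨h₁.wf.2.1, h₂.wf.2.2⟩⟩
  | _, _, _, .all h₁ h₂ =>
    ⟨h₁.wf.1, STy.wf_all.2 ⟨h₁.wf.2.2, h₂.wf.2.1.change_ty⟩,
      STy.wf_all.2 ⟨h₁.wf.2.1, h₂.wf.2.2⟩⟩
  | _, _, _, .qall h₁ h₂ =>
    ⟨h₁.wf.1, STy.wf_qall.2 ⟨h₁.wf.2.2, h₂.wf.2.1.change_qu⟩,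
      STy.wf_qall.2 ⟨h₁.wf.2.1, h₂.wf.2.2⟩⟩
theorem QTy.Sub.wf : ∀ {Γ : Ctx L} {T U : QTy L}, QTy.Sub Γ T U → Γ.WF ∧ T.WF Γ ∧ U.WF Γ
  | _, _, _, .qtype h₁ h₂ =>
    ⟨h₁.wf.1, QTy.wf_mk.2 ⟨h₁.wf.2.1, h₂.wf.2.1⟩, QTy.wf_mk.2 ⟨h₁.wf.2.2, h₂.wf.2.2⟩⟩
end

mutual
theorem STy.Sub.refl : ∀ {Γ : Ctx L} {S : STy L}, Γ.WF → S.WF Γ → STy.Sub Γ S S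
  | _, .top, hΓ, hS => .top hΓ hS
  | _, .var _, hΓ, hS => .reflVar hΓ hS
  | _, .arrow _ _, hΓ, hS =>
    .arrow (QTy.Sub.refl hΓ (STy.wf_arrow.1 hS).1) (QTy.Sub.refl hΓ (STy.wf_arrow.1 hS).2)
  | _, .all _ _, hΓ, hS =>
    .all (STy.Sub.refl hΓ (STy.wf_all.1 hS).1)
      (QTy.Sub.refl ⟨hΓ, (STy.wf_all.1 hS).1⟩ (STy.wf_all.1 hS).2)
  | _, .qall _ _, hΓ, hS =>
    .qall (Subqual.refl hΓ (STy.wf_qall.1 hS).1)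
      (QTy.Sub.refl ⟨hΓ, (STy.wf_qall.1 hS).1⟩ (STy.wf_qall.1 hS).2)
theorem QTy.Sub.refl : ∀ {Γ : Ctx L} {T : QTy L}, Γ.WF → T.WF Γ → QTy.Sub Γ T T
  | _, .mk _ _, hΓ, hT =>
    .qtype (Subqual.refl hΓ (QTy.wf_mk.1 hT).1) (STy.Sub.refl hΓ (QTy.wf_mk.1 hT).2)
end

mutual
theorem STy.Sub.rename : ∀ {Γ Δ : Ctx L} {ρX ρY : ℕ → ℕ} {S U : STy L}, STy.Sub Γ S U →
    RenHom Γ Δ ρX ρY → STy.Sub Δ (S.rename ρX ρY) (U.rename ρX ρY)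
  | _, _, _, _, _, _, .top _ hS, hρ => by
      simpa only [STy.rename] using .top hρ.wf (hS.rename hρ.bindsTy hρ.bindsQual)
  | _, _, _, _, _, _, .reflVar _ hX, hρ => by
      simpa only [STy.rename] using
        .reflVar hρ.wf (STy.wf_var.2 (hρ.bindsTy _ (STy.wf_var.1 hX)))
  | _, _, _, _, _, _, .var hX h, hρ => by
      simpa only [STy.rename] using .var (hρ.ty hX) (h.rename hρ)
  | _, _, _, _, _, _, .arrow h₁ h₂, hρ => by
      simpa only [STy.rename] using .arrow (h₁.rename hρ) (h₂.rename hρ)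
  | _, _, _, _, _, _, .all h₁ h₂, hρ => by
      have h := h₁.rename hρ
      simpa only [STy.rename] using .all h (h₂.rename (hρ.up_ty h.wf.2.1))
  | _, _, _, _, _, _, .qall h₁ h₂, hρ => by
      have h := h₁.rename hρ
      simpa only [STy.rename] using .qall h (h₂.rename (hρ.up_qu h.wf.2.1))
theorem QTy.Sub.rename : ∀ {Γ Δ : Ctx L} {ρX ρY : ℕ → ℕ} {T U : QTy L}, QTy.Sub Γ T U →
    RenHom Γ Δ ρX ρY → QTy.Sub Δ (T.rename ρX ρY) (U.rename ρX ρY)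
  | _, _, _, _, _, _, .qtype h₁ h₂, hρ => by
      simpa only [QTy.rename] using .qtype (h₁.rename hρ) (h₂.rename hρ)
end

/-- A class of simple types, closed under renaming, through which subtyping is transitive. -/
structure CutClass (good : STy L → Prop) : Prop where
  rename : ∀ {S ρX ρY}, good S → good (S.rename ρX ρY)
  trans : ∀ {Γ S M U}, good M → STy.Sub Γ S M → STy.Sub Γ M U → STy.Sub Γ S U

/-- The substitution `τ`, `σ` respects the bounds of `Γ` in `Δ`. Type variables go either to
variables with the same bound or to subtypes of a bound in the class `good`. -/
structure SubstHom (good : STy L → Prop) (Γ Δ : Ctx L) (τ : ℕ → STy L) (σ : ℕ → Qual L) :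
    Prop where
  wf : Δ.WF
  qual : ∀ {Y Q}, HasQual Γ Y Q → Subqual Δ (σ Y) (Q.subst σ)
  ty : ∀ {X S}, HasTy Γ X S → (∃ X', τ X = .var X' ∧ HasTy Δ X' (S.subst τ σ)) ∨
    (STy.Sub Δ (τ X) (S.subst τ σ) ∧ good (S.subst τ σ))

namespace SubstHom
variable {good : STy L → Prop} {Γ Δ : Ctx L} {τ : ℕ → STy L} {σ : ℕ → Qual L}

theorem qual_wf (h : SubstHom good Γ Δ τ σ) (Y : ℕ) : Γ.BindsQual Y → (σ Y).WF Δ :=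
  fun ⟨_, hY⟩ => (h.qual hY).wf.2.1

theorem ty_wf (h : SubstHom good Γ Δ τ σ) (X : ℕ) : Γ.BindsTy X → (τ X).WF Δ := by
  rintro ⟨_, hX⟩
  rcases h.ty hX with ⟨X', e, hX'⟩ | ⟨hs, -⟩
  · rw [e]; exact STy.wf_var.2 ⟨_, hX'⟩
  · exact hs.wf.2.1

/-- The fresh variable goes to itself with its substituted bound, the first alternative of
`SubstHom.ty`. Thus bounds met under binders need not lie in `good`, which is essential when `good`
limits the size. -/
theorem up_ty (hg : CutClass good) (h : SubstHom good Γ Δ τ σ) {S : STy L}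
    (hS : (S.subst τ σ).WF Δ) :
    SubstHom good (.ty Γ S) (.ty Δ (S.subst τ σ)) (STy.up τ) σ where
  wf := ⟨h.wf, hS⟩
  qual {Y Q} hY := by
    cases hY with
    | ty hY => simpa using (h.qual hY).rename (RenHom.weaken_ty ⟨h.wf, hS⟩)
  ty {X U} hX := by
    cases hX with
    | here =>
      rw [STy.subst_up_rename_succ]
      exact .inl ⟨0, rfl, .here⟩
    | ty hX =>
      rw [STy.subst_up_rename_succ]
      rcases h.ty hX with ⟨X', e, hX'⟩ | ⟨hs, hU⟩
      · exact .inl ⟨X' + 1, by simp [e, STy.rename], hX'.ty⟩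
      · exact .inr ⟨hs.rename (RenHom.weaken_ty ⟨h.wf, hS⟩), hg.rename hU⟩

theorem up_qu (hg : CutClass good) (h : SubstHom good Γ Δ τ σ) {Q : Qual L}
    (hQ : (Q.subst σ).WF Δ) :
    SubstHom good (.qu Γ Q) (.qu Δ (Q.subst σ)) (fun n => (τ n).rename id Nat.succ)
      (Qual.up σ) where
  wf := ⟨h.wf, hQ⟩
  qual {Y R} hY := by
    cases hY with
    | here =>
      rw [Qual.subst_up_rename_succ]
      exact .var .here (Subqual.refl (Γ := .qu Δ (Q.subst σ)) ⟨h.wf, hQ⟩ hQ.weaken_qu)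
    | qu hY =>
      rw [Qual.subst_up_rename_succ]
      exact (h.qual hY).rename (RenHom.weaken_qu ⟨h.wf, hQ⟩)
  ty {X U} hX := by
    cases hX with
    | qu hX =>
      rw [STy.subst_qup_rename_succ]
      rcases h.ty hX with ⟨X', e, hX'⟩ | ⟨hs, hU⟩
      · exact .inl ⟨X', by simp [e, STy.rename], hX'.qu⟩
      · exact .inr ⟨hs.rename (RenHom.weaken_qu ⟨h.wf, hQ⟩), hg.rename hU⟩

theorem up_tm (h : SubstHom good Γ Δ τ σ) {T : QTy L}
    (hT : (T.subst τ σ).WF Δ) :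
    SubstHom good (.tm Γ T) (.tm Δ (T.subst τ σ)) τ σ where
  wf := ⟨h.wf, hT⟩
  qual {Y Q} hY := by
    cases hY with
    | tm hY => simpa using (h.qual hY).rename (RenHom.weaken_tm ⟨h.wf, hT⟩)
  ty {X U} hX := by
    cases hX with
    | tm hX =>
      rcases h.ty hX with ⟨X', e, hX'⟩ | ⟨hs, hU⟩
      · exact .inl ⟨X', e, hX'.tm⟩
      · exact .inr ⟨by simpa using hs.rename (RenHom.weaken_tm ⟨h.wf, hT⟩), hU⟩

/-- Narrowing as an identity substitution. Only the narrowed variable changes its bound, so only `S`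
has to lie in `good`. -/
theorem narrow_ty (hg : CutClass good) {S U : STy L} (hS : good S) (h : STy.Sub Γ U S) :
    SubstHom good (.ty Γ S) (.ty Γ U) STy.var Qual.var where
  wf := ⟨h.wf.1, h.wf.2.1⟩
  qual {Y Q} hY := by
    have hΓ : (Ctx.ty Γ U).WF := ⟨h.wf.1, h.wf.2.1⟩
    cases hY with
    | ty hY => simpa using Subqual.var hY.ty (Subqual.refl hΓ (hY.ty.wf hΓ))
  ty {X V} hX := by
    cases hX with
    | here =>
      refine .inr ⟨?_, by simpa using hg.rename hS⟩
      simpa using STy.Sub.var .here (h.rename (RenHom.weaken_ty ⟨h.wf.1, h.wf.2.1⟩))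
    | ty hX => exact .inl ⟨_, rfl, by simpa using hX.ty⟩

/-- No condition on `good` appears, since transitivity of subqualification is available without
restriction. -/
theorem narrow_qu {Q R : Qual L} (h : Subqual Γ R Q) :
    SubstHom good (.qu Γ Q) (.qu Γ R) STy.var Qual.var where
  wf := ⟨h.wf.1, h.wf.2.1⟩
  qual {Y Q} hY := by
    have hΓ : (Ctx.qu Γ R).WF := ⟨h.wf.1, h.wf.2.1⟩
    cases hY with
    | here => simpa using Subqual.var .here (h.rename (RenHom.weaken_qu hΓ))
    | qu hY => simpa using Subqual.var hY.qu (Subqual.refl hΓ (hY.qu.wf hΓ))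
  ty {X V} hX := by
    cases hX with
    | qu hX => exact .inl ⟨_, rfl, by simpa using hX.qu⟩

end SubstHom

mutual
theorem STy.Sub.subst {good : STy L → Prop} (hg : CutClass good) :
    ∀ {Γ Δ : Ctx L} {τ : ℕ → STy L} {σ : ℕ → Qual L} {S U : STy L}, STy.Sub Γ S U →
    SubstHom good Γ Δ τ σ → STy.Sub Δ (S.subst τ σ) (U.subst τ σ)
  | _, _, _, _, _, _, .top _ hS, hτ => by
      simpa only [STy.subst] using .top hτ.wf (hS.subst hτ.ty_wf hτ.qual_wf)
  | _, _, _, _, _, _, .reflVar _ hX, hτ => by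
      simpa only [STy.subst] using STy.Sub.refl hτ.wf (hτ.ty_wf _ (STy.wf_var.1 hX))
  | _, _, _, _, _, _, .var hX h, hτ => by
      have ih := h.subst hg hτ
      simp only [STy.subst]
      -- A variable kept as a variable reuses the variable rule. Only a genuine replacement calls
      -- for a cut, and its middle type is the substituted bound, which lies in `good`.
      rcases hτ.ty hX with ⟨X', e, hX'⟩ | ⟨hs, hS⟩
      · rw [e]; exact .var hX' ih
      · exact hg.trans hS hs ih
  | _, _, _, _, _, _, .arrow h₁ h₂, hτ => by
      simpa only [STy.subst] using .arrow (h₁.subst hg hτ) (h₂.subst hg hτ)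
  | _, _, _, _, _, _, .all h₁ h₂, hτ => by
      have h := h₁.subst hg hτ
      simpa only [STy.subst] using .all h (h₂.subst hg (hτ.up_ty hg h.wf.2.1))
  | _, _, _, _, _, _, .qall h₁ h₂, hτ => by
      have h := h₁.subst hτ.wf hτ.qual
      simpa only [STy.subst] using .qall h (h₂.subst hg (hτ.up_qu hg h.wf.2.1))
theorem QTy.Sub.subst {good : STy L → Prop} (hg : CutClass good) :
    ∀ {Γ Δ : Ctx L} {τ : ℕ → STy L} {σ : ℕ → Qual L} {T U : QTy L}, QTy.Sub Γ T U →
    SubstHom good Γ Δ τ σ → QTy.Sub Δ (T.subst τ σ) (U.subst τ σ)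
  | _, _, _, _, _, _, .qtype h₁ h₂, hτ => by
      simpa only [QTy.subst] using .qtype (h₁.subst hτ.wf hτ.qual) (h₂.subst hg hτ)
end

-- Transitivity of subtyping by induction on the size of the middle type

theorem QTy.Sub.trans_of_cutClass {n : ℕ} (hg : CutClass fun S : STy L => S.size < n) {Γ : Ctx L}
    {T M U : QTy L} (hM : M.size < n) (h₁ : QTy.Sub Γ T M) (h₂ : QTy.Sub Γ M U) :
    QTy.Sub Γ T U := by
  cases h₁ with
  | qtype hq₁ hs₁ =>
    cases h₂ with
    | qtype hq₂ hs₂ => exact .qtype (hq₁.trans hq₂) (hg.trans hM hs₁ hs₂)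

/-- Recursion on the first derivation, because its variable rule keeps the middle type unchanged. In
the other nontrivial cases the cuts fall on proper components of the middle type, which have size
below `n`. -/
theorem STy.Sub.trans_of_cutClass {n : ℕ} (hg : CutClass fun S : STy L => S.size < n) :
    ∀ {Γ : Ctx L} {S M U : STy L}, STy.Sub Γ S M → M.size ≤ n → STy.Sub Γ M U → STy.Sub Γ S U
  | _, _, _, _, .top hΓ hS, _, h => by
      cases h with
      | top => exact .top hΓ hS
  | _, _, _, _, .reflVar _ _, _, h => h
  | _, _, _, _, .var hX h', hM, h => .var hX (STy.Sub.trans_of_cutClass hg h' hM h)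
  | _, _, _, _, .arrow h₁ h₂, hM, h => by
      simp only [STy.size] at hM
      cases h with
      | top hΓ => exact .top hΓ (STy.Sub.arrow h₁ h₂).wf.2.1
      | arrow h₃ h₄ =>
        exact .arrow (h₃.trans_of_cutClass hg (by omega) h₁)
          (h₂.trans_of_cutClass hg (by omega) h₄)
  | _, _, _, _, .all h₁ h₂, hM, h => by
      simp only [STy.size] at hM
      cases h with
      | top hΓ => exact .top hΓ (STy.Sub.all h₁ h₂).wf.2.1
      | all h₃ h₄ =>
        -- The bodies on the left are compared under the middle bound and must be moved to the
        -- smaller right-hand bound; the middle bound is a proper component, so it can be narrowed.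
        have h₂' := h₂.subst hg (SubstHom.narrow_ty hg (by omega) h₃)
        simp only [QTy.subst_var] at h₂'
        exact .all (hg.trans (by omega) h₃ h₁) (h₂'.trans_of_cutClass hg (by omega) h₄)
  | _, _, _, _, .qall h₁ h₂, hM, h => by
      simp only [STy.size] at hM
      cases h with
      | top hΓ => exact .top hΓ (STy.Sub.qall h₁ h₂).wf.2.1
      | qall h₃ h₄ =>
        have h₂' := h₂.subst hg (SubstHom.narrow_qu h₃)
        simp only [QTy.subst_var] at h₂'
        exact .qall (h₃.trans h₁) (h₂'.trans_of_cutClass hg (by omega) h₄)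

theorem cutClass_size_lt (n : ℕ) : CutClass fun S : STy L => S.size < n := by
  induction n with
  | zero => exact ⟨fun h => absurd h (Nat.not_lt_zero _), fun h => absurd h (Nat.not_lt_zero _)⟩
  | succ n ih =>
    exact ⟨fun h => by rwa [STy.size_rename],
      fun hM h₁ h₂ => h₁.trans_of_cutClass ih (Nat.lt_succ_iff.1 hM) h₂⟩

theorem STy.Sub.trans {Γ : Ctx L} {S M U : STy L} (h₁ : STy.Sub Γ S M) (h₂ : STy.Sub Γ M U) :
    STy.Sub Γ S U :=
  -- The bound in the class is strict, hence the successor.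
  (cutClass_size_lt (M.size + 1)).trans (Nat.lt_succ_self _) h₁ h₂

theorem QTy.Sub.trans {Γ : Ctx L} {T M U : QTy L} (h₁ : QTy.Sub Γ T M) (h₂ : QTy.Sub Γ M U) :
    QTy.Sub Γ T U :=
  h₁.trans_of_cutClass (cutClass_size_lt (M.size + 1)) (Nat.lt_succ_self _) h₂

theorem cutClass_true : CutClass fun _ : STy L => True :=
  ⟨fun _ => trivial, fun _ h₁ h₂ => h₁.trans h₂⟩

/-- The substitution `τ`, `σ` respects the bounds of `Γ` in `Δ`. -/
abbrev BoundedSubst (Γ Δ : Ctx L) (τ : ℕ → STy L) (σ : ℕ → Qual L) : Prop :=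
  SubstHom (fun _ => True) Γ Δ τ σ

namespace BoundedSubst
variable {Γ : Ctx L}

theorem single_ty {S U : STy L} (h : STy.Sub Γ U S) :
    BoundedSubst (.ty Γ S) Γ (STy.single U) Qual.var where
  wf := h.wf.1
  qual {Y Q} hY := by
    cases hY with
    | ty hY => simpa using Subqual.var hY (Subqual.refl h.wf.1 (hY.wf h.wf.1))
  ty {X V} hX := by
    cases hX with
    | here =>
      rw [STy.subst_single_rename_succ]
      exact .inr ⟨h, trivial⟩
    | ty hX =>
      rw [STy.subst_single_rename_succ]
      exact .inl ⟨_, rfl, hX⟩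

theorem single_qu {Q R : Qual L} (h : Subqual Γ R Q) :
    BoundedSubst (.qu Γ Q) Γ STy.var (Qual.single R) where
  wf := h.wf.1
  qual {Y Q} hY := by
    cases hY with
    | here => rw [Qual.subst_single_rename_succ]; exact h
    | qu hY =>
      rw [Qual.subst_single_rename_succ]
      exact Subqual.var hY (Subqual.refl h.wf.1 (hY.wf h.wf.1))
  ty {X V} hX := by
    cases hX with
    | qu hX =>
      rw [STy.subst_qsingle_rename_succ]
      exact .inl ⟨_, rfl, hX⟩

/-- The type-level part of substituting a term: removing a term variable leaves all bounds
unchanged. -/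
theorem drop_tm {T : QTy L} (hΓ : Γ.WF) : BoundedSubst (.tm Γ T) Γ STy.var Qual.var where
  wf := hΓ
  qual {Y Q} hY := by
    cases hY with
    | tm hY => simpa using Subqual.var hY (Subqual.refl hΓ (hY.wf hΓ))
  ty {X V} hX := by
    cases hX with
    | tm hX => exact .inl ⟨_, rfl, by simpa using hX⟩

end BoundedSubst

end Subtyping

/-! ### Typing -/

section Typing
variable {L : Type u} [Lattice L] [BoundedOrder L]

theorem Typing.wf {Γ : Ctx L} {t : Term L} {T : QTy L} (h : Typing Γ t T) :
    Γ.WF ∧ T.WF Γ := by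
  induction h with
  | var hΓ hx => exact ⟨hΓ, hx.wf hΓ⟩
  | abs hP _ ih =>
    exact ⟨ih.1.1, QTy.wf_mk.2 ⟨hP, STy.wf_arrow.2 ⟨ih.1.2, ih.2.strengthen_tm⟩⟩⟩
  | app _ _ ih _ => exact ⟨ih.1, (STy.wf_arrow.1 (QTy.wf_mk.1 ih.2).2).2⟩
  | tabs hP _ ih => exact ⟨ih.1.1, QTy.wf_mk.2 ⟨hP, STy.wf_all.2 ⟨ih.1.2, ih.2⟩⟩⟩
  | tapp _ hS ih =>
    exact ⟨ih.1, (STy.wf_all.1 (QTy.wf_mk.1 ih.2).2).2.substTy hS.wf.2.1⟩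
  | qabs hP _ ih => exact ⟨ih.1.1, QTy.wf_mk.2 ⟨hP, STy.wf_qall.2 ⟨ih.1.2, ih.2⟩⟩⟩
  | qapp _ hQ ih =>
    exact ⟨ih.1, (STy.wf_qall.1 (QTy.wf_mk.1 ih.2).2).2.substQual hQ.wf.2.1⟩
  | assertq _ _ ih => exact ih
  | upqual _ hP ih => exact ⟨ih.1, QTy.wf_mk.2 ⟨hP.wf.2.2, (QTy.wf_mk.1 ih.2).2⟩⟩
  | sub _ hT ih => exact ⟨ih.1, hT.wf.2.2⟩

/-- Supplies the weakenings for `Typing.subst` under binders. Term variables have their own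
hypothesis because `RenHom` records only what subtyping sees. -/
theorem Typing.rename {Γ Δ : Ctx L} {ρx ρX ρY : ℕ → ℕ} {t : Term L} {T : QTy L}
    (h : Typing Γ t T) (hρ : RenHom Γ Δ ρX ρY)
    (hx : ∀ {x T}, HasTerm Γ x T → HasTerm Δ (ρx x) (T.rename ρX ρY)) :
    Typing Δ (t.rename ρx ρX ρY) (T.rename ρX ρY) := by
  induction h generalizing Δ ρx ρX ρY with
  | var _ h => exact .var hρ.wf (hx h)
  | abs hP ht ih =>
    simp only [Term.rename, QTy.rename, STy.rename]
    refine .abs (hP.rename hρ.bindsQual)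
      (ih (hρ.up_tm (ht.wf.1.2.rename hρ.bindsTy hρ.bindsQual)) fun h => ?_)
    cases h with
    | here => exact .here
    | tm h => exact .tm (hx h)
  | app _ _ ih₁ ih₂ =>
    have h₁ := ih₁ hρ hx
    simp only [QTy.rename, STy.rename] at h₁
    exact .app h₁ (ih₂ hρ hx)
  | tabs hP ht ih =>
    simp only [Term.rename, QTy.rename, STy.rename]
    refine .tabs (hP.rename hρ.bindsQual)
      (ih (hρ.up_ty (ht.wf.1.2.rename hρ.bindsTy hρ.bindsQual)) fun h => ?_)
    cases h with
    | ty h => simpa [QTy.rename_rename] using (hx h).ty (S := _)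
  | tapp _ hS ih =>
    have h₁ := ih hρ hx
    simp only [QTy.rename, STy.rename] at h₁
    rw [QTy.rename_substTy]
    exact .tapp h₁ (hS.rename hρ)
  | qabs hP ht ih =>
    simp only [Term.rename, QTy.rename, STy.rename]
    refine .qabs (hP.rename hρ.bindsQual)
      (ih (hρ.up_qu (ht.wf.1.2.rename hρ.bindsQual)) fun h => ?_)
    cases h with
    | qu h => simpa [QTy.rename_rename] using (hx h).qu (R := _)
  | qapp _ hQ ih =>
    have h₁ := ih hρ hx
    simp only [QTy.rename, STy.rename] at h₁
    rw [QTy.rename_substQual]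
    exact .qapp h₁ (hQ.rename hρ)
  | assertq _ hQ ih =>
    have h₁ := ih hρ hx
    simp only [QTy.rename] at h₁ ⊢
    exact .assertq h₁ (hQ.rename hρ)
  | upqual _ hQ ih =>
    have h₁ := ih hρ hx
    simp only [QTy.rename] at h₁ ⊢
    exact .upqual h₁ (hQ.rename hρ)
  | sub _ hT ih => exact .sub (ih hρ hx) (hT.rename hρ)

/-- Substituting for all three sorts at once makes the three beta rules instances of a single
induction. Under a binder, the typings of the substituted terms are restored by weakening. -/
theorem Typing.subst {Γ Δ : Ctx L} {θ : ℕ → Term L} {τ : ℕ → STy L} {σ : ℕ → Qual L}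
    {t : Term L} {T : QTy L} (h : Typing Γ t T) (hτ : BoundedSubst Γ Δ τ σ)
    (hθ : ∀ {x T}, HasTerm Γ x T → Typing Δ (θ x) (T.subst τ σ)) :
    Typing Δ (t.subst θ τ σ) (T.subst τ σ) := by
  induction h generalizing Δ θ τ σ with
  | var _ h => exact hθ h
  | abs hP ht ih =>
    simp only [Term.subst, QTy.subst, STy.subst]
    have hτ' := hτ.up_tm (ht.wf.1.2.subst hτ.ty_wf hτ.qual_wf)
    refine .abs (hP.subst hτ.qual_wf) (ih hτ' fun h => ?_)
    cases h with
    | here => exact .var hτ'.wf .here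
    | tm h =>
      simpa [Term.up] using (hθ h).rename (RenHom.weaken_tm hτ'.wf) (ρx := Nat.succ)
        fun h => by simpa using h.tm
  | app _ _ ih₁ ih₂ =>
    have h₁ := ih₁ hτ hθ
    simp only [QTy.subst, STy.subst] at h₁
    exact .app h₁ (ih₂ hτ hθ)
  | tabs hP ht ih =>
    simp only [Term.subst, QTy.subst, STy.subst]
    have hτ' := hτ.up_ty cutClass_true (ht.wf.1.2.subst hτ.ty_wf hτ.qual_wf)
    refine .tabs (hP.subst hτ.qual_wf) (ih hτ' fun h => ?_)
    cases h with
    | ty h =>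
      rw [QTy.subst_up_rename_succ]
      exact (hθ h).rename (RenHom.weaken_ty hτ'.wf) fun h => h.ty
  | tapp _ hS ih =>
    have h₁ := ih hτ hθ
    simp only [QTy.subst, STy.subst] at h₁
    rw [QTy.subst_substTy]
    exact .tapp h₁ (hS.subst cutClass_true hτ)
  | qabs hP ht ih =>
    simp only [Term.subst, QTy.subst, STy.subst]
    have hτ' := hτ.up_qu cutClass_true (ht.wf.1.2.subst hτ.qual_wf)
    refine .qabs (hP.subst hτ.qual_wf) (ih hτ' fun h => ?_)
    cases h with
    | qu h =>
      rw [QTy.subst_qup_rename_succ]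
      exact (hθ h).rename (RenHom.weaken_qu hτ'.wf) fun h => h.qu
  | qapp _ hQ ih =>
    have h₁ := ih hτ hθ
    simp only [QTy.subst, STy.subst] at h₁
    rw [QTy.subst_substQual]
    exact .qapp h₁ (hQ.subst hτ.wf hτ.qual)
  | assertq _ hQ ih =>
    have h₁ := ih hτ hθ
    simp only [QTy.subst] at h₁ ⊢
    exact .assertq h₁ (hQ.subst hτ.wf hτ.qual)
  | upqual _ hQ ih =>
    have h₁ := ih hτ hθ
    simp only [QTy.subst] at h₁ ⊢
    exact .upqual h₁ (hQ.subst hτ.wf hτ.qual)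
  | sub _ hT ih => exact .sub (ih hτ hθ) (hT.subst cutClass_true hτ)

theorem Typing.substTerm {Γ : Ctx L} {t v : Term L} {T U : QTy L} (h : Typing (.tm Γ U) t T)
    (hv : Typing Γ v U) : Typing Γ (t.substTerm v) T := by
  -- The type is written as its own identity instance to match the simultaneous substitution lemma.
  rw [← QTy.subst_var T]
  refine h.subst (BoundedSubst.drop_tm hv.wf.1) fun hx => ?_
  rw [QTy.subst_var]
  cases hx with
  | here => exact hv
  | tm hx => exact .var hv.wf.1 hx

theorem Typing.substTy {Γ : Ctx L} {t : Term L} {T : QTy L} {S U : STy L}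
    (h : Typing (.ty Γ U) t T) (hS : STy.Sub Γ S U) : Typing Γ (t.substTy S) (T.substTy S) := by
  refine h.subst (BoundedSubst.single_ty hS) fun hx => ?_
  cases hx with
  | ty hx =>
    rw [QTy.subst_single_rename_succ]
    exact .var hS.wf.1 hx

theorem Typing.substQual {Γ : Ctx L} {t : Term L} {T : QTy L} {Q R : Qual L}
    (h : Typing (.qu Γ R) t T) (hQ : Subqual Γ Q R) :
    Typing Γ (t.substQual Q) (T.substQual Q) := by
  refine h.subst (BoundedSubst.single_qu hQ) fun hx => ?_
  cases hx with
  | qu hx =>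
    rw [QTy.subst_qsingle_rename_succ]
    exact .var hQ.wf.1 hx

-- Inversion of typing for abstractions, and preservation

theorem Typing.abs_inv {Γ : Ctx L} {P : Qual L} {U T : QTy L} {t : Term L}
    (h : Typing Γ (.abs P U t) T) :
    ∃ V, Typing (.tm Γ U) t V ∧ QTy.Sub Γ (.mk P (.arrow U V)) T := by
  generalize e : Term.abs P U t = s at h
  induction h with
  | abs hP ht =>
    cases e
    exact ⟨_, ht, QTy.Sub.refl ht.wf.1.1 (Typing.abs hP ht).wf.2⟩
  | sub _ hT ih =>
    obtain ⟨V, hV, hs⟩ := ih e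
    exact ⟨V, hV, hs.trans hT⟩
  | _ => cases e

theorem Typing.tabs_inv {Γ : Ctx L} {P : Qual L} {U : STy L} {T : QTy L} {t : Term L}
    (h : Typing Γ (.tabs P U t) T) :
    ∃ V, Typing (.ty Γ U) t V ∧ QTy.Sub Γ (.mk P (.all U V)) T := by
  generalize e : Term.tabs P U t = s at h
  induction h with
  | tabs hP ht =>
    cases e
    exact ⟨_, ht, QTy.Sub.refl ht.wf.1.1 (Typing.tabs hP ht).wf.2⟩
  | sub _ hT ih =>
    obtain ⟨V, hV, hs⟩ := ih e
    exact ⟨V, hV, hs.trans hT⟩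
  | _ => cases e

theorem Typing.qabs_inv {Γ : Ctx L} {P R : Qual L} {T : QTy L} {t : Term L}
    (h : Typing Γ (.qabs P R t) T) :
    ∃ V, Typing (.qu Γ R) t V ∧ QTy.Sub Γ (.mk P (.qall R V)) T := by
  generalize e : Term.qabs P R t = s at h
  induction h with
  | qabs hP ht =>
    cases e
    exact ⟨_, ht, QTy.Sub.refl ht.wf.1.1 (Typing.qabs hP ht).wf.2⟩
  | sub _ hT ih =>
    obtain ⟨V, hV, hs⟩ := ih e
    exact ⟨V, hV, hs.trans hT⟩
  | _ => cases e

/-- Subtyping of qualified types splits into independent qualifier and simple parts. Inversion thus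
provides the simple part, which is recombined with the new tag. -/
theorem Typing.retag {Γ : Ctx L} {v : Term L} {P Q R : Qual L} {S : STy L}
    (h : Typing Γ v (.mk Q S)) (hv : ValueTag v R) (hP : P.WF Γ) :
    Typing Γ (v.retag P) (.mk P S) := by
  have hPP := Subqual.refl h.wf.1 hP
  cases hv with
  | abs =>
    obtain ⟨V, ht, hs⟩ := h.abs_inv
    cases hs with
    | qtype _ hs => exact .sub (.abs hP ht) (.qtype hPP hs)
  | tabs =>
    obtain ⟨V, ht, hs⟩ := h.tabs_inv
    cases hs with
    | qtype _ hs => exact .sub (.tabs hP ht) (.qtype hPP hs)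
  | qabs =>
    obtain ⟨V, ht, hs⟩ := h.qabs_inv
    cases hs with
    | qtype _ hs => exact .sub (.qabs hP ht) (.qtype hPP hs)

theorem Typing.preservation {Γ : Ctx L} {s t : Term L} {T : QTy L} (hs : Typing Γ s T)
    (hst : Step s t) : Typing Γ t T := by
  induction hs generalizing t with
  | var => cases hst
  | abs => cases hst
  | tabs => cases hst
  | qabs => cases hst
  | app h₁ h₂ ih₁ ih₂ =>
    cases hst with
    | beta =>
      obtain ⟨V, hb, hs⟩ := h₁.abs_inv
      cases hs with
      | qtype _ hs =>
        cases hs with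
        -- Contravariance lifts the argument to the annotated domain; covariance lifts the result to
        -- the expected type.
        | arrow hU hV => exact .sub (hb.substTerm (.sub h₂ hU)) hV
    | app₁ h => exact .app (ih₁ h) h₂
    | app₂ _ h => exact .app h₁ (ih₂ h)
  | tapp h₁ hS ih =>
    cases hst with
    | betaT =>
      obtain ⟨V, hb, hs⟩ := h₁.tabs_inv
      cases hs with
      | qtype _ hs =>
        cases hs with
        | all hU hV =>
          -- The argument lies below the bound in the type used, hence below the annotation. The
          -- codomain subtyping assumes only the former bound, so the argument can be substituted
          -- into it as well.
          exact .sub (hb.substTy (hS.trans hU))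
            (hV.subst cutClass_true (BoundedSubst.single_ty hS))
    | tapp h => exact .tapp (ih h) hS
  | qapp h₁ hQ ih =>
    cases hst with
    | betaQ =>
      obtain ⟨V, hb, hs⟩ := h₁.qabs_inv
      cases hs with
      | qtype _ hs =>
        cases hs with
        | qall hU hV =>
          exact .sub (hb.substQual (hQ.trans hU))
            (hV.subst cutClass_true (BoundedSubst.single_qu hQ))
    | qapp h => exact .qapp (ih h) hQ
  | assertq h₁ hQ ih =>
    cases hst with
    | assertq => exact h₁
    | assertqCongr h => exact .assertq (ih h) hQ
  | upqual h₁ hQ ih =>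
    cases hst with
    | upqual hv => exact h₁.retag hv hQ.wf.2.2
    | upqualCongr h => exact .upqual (ih h) hQ
  | sub _ hT ih => exact .sub (ih hst) hT

end Typing

end FsubQ

theorem mainTheorem3 {L : Type*} [Lattice L] [BoundedOrder L] [Countable L]
    (Γ : FsubQ.Ctx L) (s t : FsubQ.Term L) (T : FsubQ.QTy L)
    (hs : FsubQ.Typing Γ s T) (hst : FsubQ.Step s t) :
    FsubQ.Typing Γ t T := by
  exact hs.preservation hst
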